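/- For a permutation $\pi=\pi_1\cdots\pi_n$ of $\{1,\dots,n\}$ written in one-line notation, let $s(\pi)$ be the output of the following procedure (West's stack-sorting map). Start with an empty stack and empty output. At each step, if the stack is empty and input remains, or if the next entry of the input is smaller than the entry at the top of the stack, push the next input entry onto the stack; otherwise (in particular, when the input is exhausted) pop the top of the stack and append it to the end of the output. Stop when the output has length $n$. For $t\ge 1$, let $W_t(n)$ be the number of permutations $\pi$ of $\{1,\dots,n\}$ such that $s^t(\pi)$ is the increasing permutation $12\cdots n$, where $s^t$ is the $t$-fold iterate of $s$. A sequence $(a_n)_{n\ge1}$ of positive numbers is called log-convex if $(a_{n+1}/a_n)_{n\ge1}$ is nondecreasing. If the sequence $(W_3(n))_{n\ge1}$ is log-convex, then $W_3(n)>\binom{4n}{n}$ for all sufficiently large $n$. Consequently, the following two conjectures of Bóna cannot both be true: (i) $W_t(n)\le\binom{(t+1)n}{n}$ for all $n,t\ge1$; (ii) for every $t\ge1$, the sequence $(W_t(n))_{n\ge1}$ is log-convex. -/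

import Mathlib

/-- Runs the stack-sorting procedure on the remaining input (first argument) with the given
stack (second argument, top of the stack first) and returns the part of the output that is
still to be produced. If the stack is empty, or the next input entry is smaller than the top of
the stack, the next input entry is pushed; otherwise the top of the stack is popped and appended
to the output. When the input is exhausted the stack is emptied from top to bottom. -/
def stackRun : List ℕ → List ℕ → List ℕ
  | [], stack => stack
  | x :: input, [] => stackRun input [x]
  | x :: input, y :: stack =>
    if x < y then stackRun input (x :: y :: stack)
    else y :: stackRun (x :: input) stack
termination_by input stack => 2 * input.length + stack.length

/-- West's stack-sorting map `s`, acting on permutations in one-line notation. -/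
def stackSort (π : List ℕ) : List ℕ := stackRun π []

/-- The set `S_n` of permutations of `{1, …, n}`, in one-line notation. -/
def permsOf (n : ℕ) : Finset (List ℕ) := (List.range' 1 n).permutations.toFinset

/-- `π` is `t`-stack-sortable if the `t`-fold iterate of `s` sends it to an increasing
permutation. -/
def IsStackSortable (t : ℕ) (π : List ℕ) : Prop := (stackSort^[t] π).Pairwise (· < ·)

instance (t : ℕ) (π : List ℕ) : Decidable (IsStackSortable t π) := by
  unfold IsStackSortable; infer_instance

/-- `W_t(n)`: the number of `t`-stack-sortable permutations in `S_n`. -/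
def W (t n : ℕ) : ℕ := ((permsOf n).filter (IsStackSortable t)).card

/-- Log-convexity of a sequence `(a_n)_{n ≥ 1}` of positive numbers: the sequence of ratios
`(a_{n+1} / a_n)_{n ≥ 1}` is nondecreasing. -/
def LogConvexSeq (a : ℕ → ℝ) : Prop :=
  (∀ n, 1 ≤ n → 0 < a n) ∧ ∀ n, 1 ≤ n → a (n + 1) / a n ≤ a (n + 2) / a (n + 1)

/-- Bóna's conjectured upper bound for all `W_t(n)`. -/
def BonaBoundConjecture : Prop :=
  ∀ n t : ℕ, 1 ≤ n → 1 ≤ t → W t n ≤ ((t + 1) * n).choose n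

/-- Bóna's log-convexity conjecture. -/
def BonaLogConvexConjecture : Prop :=
  ∀ t : ℕ, 1 ≤ t → LogConvexSeq (fun n => (W t n : ℝ))

/-! Since `(4n).choose n ≤ (256/27) ^ n`, log-convexity leaves two cases. If some ratio of
consecutive terms exceeds `256/27`, all later ratios are at least that large and `W 3` eventually
beats the binomial coefficient. Otherwise `W 3 (n + 1) ≤ (256/27) ^ n` for all `n`. Then at `y =
6911/2^16`, just below `27/256 = 6912/2^16`, the generating function `∑ W 3 n * y ^ n` is at most
`6911 * 6912 / 2^16 < 729`. The second case is refuted by showing that this sum is at least 730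
(`le_tailSum`).

The bound comes from a recursive inequality (`tailSum_succ_ge`). The objects are permutations whose
sorted image is a 2-stack-sortable body on `{1, …, m}` followed by a tail of `l` increasing larger
values; weight is `y ^ m`, and `l = 0` gives the 3-stack-sortable permutations. A second statistic
counts cuts `j` of the once-sorted body, where the first `j` entries are exactly `1, …, j`. Larger
objects arise in two ways. The smallest tail value may be absorbed into the body
(`HasTail.append_shift`). Or two objects are combined (`insertAt`): their bodies are placed to the
left and to the right of a new body maximum `m`, and their values are interleaved at a cut of the
right one. The right object is inserted into the left one behind a new tail entry, so that sorting
yields the wanted order (`stackRun_insert`). These operations are jointly injective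
(`build_injective`), which is all that a lower bound needs.

The inequality is monotone with nonnegative terms, so iterating it from zero yields lower bounds
however the sums are truncated or rounded down. The iteration runs in fixed-point arithmetic on a
finite table packed into a single integer, one multiplication performing all convolutions, and the
kernel evaluates it. -/

/-! ### Elementary properties of stack-sorting -/

theorem stackRun_perm (w S : List ℕ) : (stackRun w S).Perm (w ++ S) := by
  induction w, S using stackRun.induct with
  | case1 S => simp [stackRun]
  | case2 x w ih =>
    rw [stackRun]
    refine ih.trans ?_
    simp
  | case3 x w y S h ih =>
    rw [stackRun, if_pos h]
    refine ih.trans ?_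
    simp
  | case4 x w y S h ih =>
    rw [stackRun, if_neg h]
    refine (ih.cons y).trans ?_
    exact List.perm_middle.symm

theorem stackSort_perm (w : List ℕ) : (stackSort w).Perm w := by
  simpa [stackSort] using stackRun_perm w []

/-- The procedure only compares entries, so it commutes with order-preserving relabelling. -/
theorem stackRun_map {f : ℕ → ℕ} (hf : StrictMono f) (w S : List ℕ) :
    stackRun (w.map f) (S.map f) = (stackRun w S).map f := by
  induction w, S using stackRun.induct with
  | case1 S => simp [stackRun]
  | case2 x w ih => simpa [stackRun] using ih
  | case3 x w y S h ih =>
    rw [stackRun, if_pos h, ← ih]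
    simp [stackRun, hf.lt_iff_lt, h]
  | case4 x w y S h ih =>
    simp only [List.map_cons] at ih ⊢
    rw [stackRun, if_neg (by simpa [hf.lt_iff_lt] using h), ih, stackRun, if_neg h, List.map_cons]

theorem stackSort_map {f : ℕ → ℕ} (hf : StrictMono f) (w : List ℕ) :
    stackSort (w.map f) = (stackSort w).map f := by
  simpa [stackSort] using stackRun_map hf w []

@[simp] theorem stackSort_nil : stackSort [] = [] := by simp [stackSort, stackRun]

theorem stackRun_push {x : ℕ} {w S : List ℕ} (h : ∀ y ∈ S.head?, x < y) :
    stackRun (x :: w) S = stackRun w (x :: S) := by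
  cases S with
  | nil => simp [stackRun]
  | cons y S => simp only [List.head?_cons, Option.mem_def, Option.some.injEq, forall_eq'] at h
                rw [stackRun, if_pos h]

theorem stackRun_pop {w S : List ℕ} {y : ℕ} (h : ∀ x ∈ w.head?, y ≤ x) :
    stackRun w (y :: S) = y :: stackRun w S := by
  cases w with
  | nil => simp [stackRun]
  | cons x w =>
    simp only [List.head?_cons, Option.mem_def, Option.some.injEq, forall_eq'] at h
    rw [stackRun, if_neg (by omega)]

/-- A factor processed above larger stack entries, and followed by a larger input entry, is
sorted independently of its surroundings. -/
theorem stackRun_append {w S R T : List ℕ} (hT : ∀ x ∈ w, ∀ y ∈ T.head?, x < y)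
    (hR : ∀ x ∈ w ++ S, ∀ r ∈ R.head?, x ≤ r) :
    stackRun (w ++ R) (S ++ T) = stackRun w S ++ stackRun R T := by
  induction w, S using stackRun.induct with
  | case1 S =>
    simp only [List.nil_append, stackRun] at *
    induction S with
    | nil => simp
    | cons y S ih =>
      rw [List.cons_append, stackRun_pop (fun x hx => hR y (by simp) x hx), ih]
      · simp
      · intro x hx; exact hR x (by simp [hx])
  | case2 x w ih =>
    rw [stackRun, List.nil_append, List.cons_append, stackRun_push (hT x (by simp))]
    refine ih (fun z hz => hT z (by simp [hz])) (fun z hz => hR z ?_)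
    simp at hz ⊢; tauto
  | case3 x w y S h ih =>
    rw [stackRun, if_pos h, List.cons_append, List.cons_append, stackRun_push (by simpa using h)]
    refine ih (fun z hz => hT z (by simp [hz])) (fun z hz => hR z ?_)
    simp at hz ⊢; tauto
  | case4 x w y S h ih =>
    rw [stackRun, if_neg h, List.cons_append, List.cons_append,
      stackRun_pop (by simpa using h), List.cons_append, ← List.cons_append, ih hT]
    intro z hz
    refine hR z ?_
    simp at hz ⊢; tauto

theorem stackSort_append_of_head {U V : List ℕ} (h : ∀ x ∈ U, ∀ y ∈ V.head?, x ≤ y) :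
    stackSort (U ++ V) = stackSort U ++ stackSort V := by
  have := stackRun_append (w := U) (S := []) (R := V) (T := []) (by simp)
    (fun x hx r hr => h x (by simpa using hx) r hr)
  simpa [stackSort] using this

theorem stackSort_append {U V : List ℕ} (h : ∀ x ∈ U, ∀ y ∈ V, x ≤ y) :
    stackSort (U ++ V) = stackSort U ++ stackSort V :=
  stackSort_append_of_head fun x hx y hy => h x hx y (List.mem_of_mem_head? hy)

theorem stackSort_cons {a : ℕ} {V : List ℕ} (h : ∀ x ∈ V, x < a) :
    stackSort (a :: V) = stackSort V ++ [a] := by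
  have := stackRun_append (w := V) (S := []) (R := []) (T := [a]) (by simpa using h) (by simp)
  simpa [stackSort, stackRun] using this

@[simp] theorem stackSort_singleton (a : ℕ) : stackSort [a] = [a] := by
  simp [stackSort, stackRun]

/-- The recursive description of the map: the maximum flushes everything before it and waits below
everything after it. -/
theorem stackSort_append_cons {U V : List ℕ} {a : ℕ} (hU : ∀ x ∈ U, x < a) (hV : ∀ x ∈ V, x < a) :
    stackSort (U ++ a :: V) = stackSort U ++ stackSort V ++ [a] := by
  rw [stackSort_append_of_head (fun x hx y hy => by simp at hy; have := hU x hx; omega),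
    stackSort_cons hV, List.append_assoc]

/-- When `m` is pushed, any smaller top entries have been popped, so the stack is empty or its top
exceeds `t`. Then `Q` runs above `m`, and the next entry, be it `t` or the head of `R`, flushes `Q`
and `m`. The inserted `t` takes the place of `m`, `ρ` is sorted above it, and the head of `R`, which
exceeds `t`, flushes both. From there on the two runs are in the same state. -/
theorem stackRun_insert {P Q R ρ S : List ℕ} {m t : ℕ} (hQ : ∀ x ∈ Q, x < m)
    (hR : ∀ x ∈ R.head?, m < x) (hmt : m < t) (hρ : ∀ x ∈ ρ, x < t)
    (hbig : ∀ x, x ∈ P ∨ x ∈ R ∨ x ∈ S → x < m ∨ t < x) :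
    ∃ U V, stackRun (P ++ m :: (Q ++ R)) S = U ++ m :: V ∧
      stackRun (P ++ m :: (Q ++ t :: (ρ ++ R))) S = U ++ m :: (stackSort ρ ++ t :: V) := by
  have hRt : ∀ x ∈ R.head?, t < x := fun x hx => by
    have h1 := hR x hx
    rcases hbig x (Or.inr (Or.inl (List.mem_of_mem_head? hx))) with h | h <;> omega
  have push : ∀ S : List ℕ, (∀ y ∈ S.head?, t < y) → ∃ U V, stackRun (m :: (Q ++ R)) S = U ++ m :: V ∧
        stackRun (m :: (Q ++ t :: (ρ ++ R))) S = U ++ m :: (stackSort ρ ++ t :: V) := by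
      intro S h
      refine ⟨stackSort Q, stackRun R S, ?_, ?_⟩
      · rw [stackRun_push (fun y hy => hmt.trans (h y hy))]
        have := stackRun_append (w := Q) (S := []) (R := R) (T := m :: S) (by simpa using hQ)
          (fun x hx r hr => (hQ x (by simpa using hx)).le.trans (hR r hr).le)
        rw [List.nil_append] at this
        rw [this, stackRun_pop (fun x hx => (hR x hx).le)]; rfl
      · rw [stackRun_push (fun y hy => hmt.trans (h y hy))]
        have := stackRun_append (w := Q) (S := []) (R := t :: (ρ ++ R)) (T := m :: S)
          (by simpa using hQ)
          (fun x hx r hr => by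
            have := hQ x (by simpa using hx)
            simp at hr; omega)
        rw [List.nil_append] at this
        rw [this, stackRun_pop (by simpa using hmt.le), stackRun_push h]
        have := stackRun_append (w := ρ) (S := []) (R := R) (T := t :: S) (by simpa using hρ)
          (fun x hx r hr => (hρ x (by simpa using hx)).le.trans (hRt r hr).le)
        rw [List.nil_append] at this
        rw [this, stackRun_pop (fun x hx => (hRt x hx).le)]; rfl
  -- Stack entries below `m` are popped identically in both runs until `push` applies.
  have base : ∀ S : List ℕ, (∀ x ∈ S, x < m ∨ t < x) →
      ∃ U V, stackRun (m :: (Q ++ R)) S = U ++ m :: V ∧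
      stackRun (m :: (Q ++ t :: (ρ ++ R))) S = U ++ m :: (stackSort ρ ++ t :: V) := by
    intro S hS
    induction S with
    | nil => exact push _ (by simp)
    | cons y S ih =>
      by_cases hy : t < y
      · exact push _ (by simpa using hy)
      · have hy' : y < m := by have := hS y (by simp); omega
        obtain ⟨U, V, h1, h2⟩ := ih (fun x hx => hS x (by simp [hx]))
        refine ⟨y :: U, V, ?_, ?_⟩ <;> rw [stackRun_pop (by simpa using hy'.le)] <;> simp [*]
  induction P, S using stackRun.induct with
  | case1 S => exact base S (fun x hx => hbig x (by simp [hx]))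
  | case2 x w ih =>
    simp only [List.cons_append]
    rw [stackRun_push (by simp), stackRun_push (by simp)]
    exact ih (fun z hz => hbig z (by simp at hz ⊢; tauto))
  | case3 x w y S h ih =>
    simp only [List.cons_append]
    rw [stackRun_push (by simpa using h), stackRun_push (by simpa using h)]
    exact ih (fun z hz => hbig z (by simp at hz ⊢; tauto))
  | case4 x w y S h ih =>
    obtain ⟨U, V, h1, h2⟩ := ih (fun z hz => hbig z (by simp at hz ⊢; tauto))
    refine ⟨y :: U, V, ?_, ?_⟩
    · rw [List.cons_append, stackRun_pop (by simpa using h), ← List.cons_append, h1]; rfl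
    · rw [List.cons_append, stackRun_pop (by simpa using h), ← List.cons_append, h2]; rfl

/-! ### Tails, cuts and relabellings -/

open Finset

/-- The `j ∈ [1, m]` such that the first `j` entries are at most `j`. -/
def cutSet (m : ℕ) (σ : List ℕ) : Finset ℕ := (Icc 1 m).filter fun j => ∀ x ∈ σ.take j, x ≤ j

theorem mem_cutSet {m : ℕ} {σ : List ℕ} {j : ℕ} :
    j ∈ cutSet m σ ↔ (1 ≤ j ∧ j ≤ m) ∧ ∀ x ∈ σ.take j, x ≤ j := by simp [cutSet]

/-- The stack-sorted image of `π` ends with the `l` largest values in increasing order, and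
the `m` entries before them form a 2-stack-sortable permutation of `{1, …, m}`. -/
def HasTail (m l : ℕ) (π : List ℕ) : Prop :=
  ∃ τ, stackSort π = τ ++ List.range' (m + 1) l ∧ stackSort (stackSort τ) = List.range' 1 m

/-- The cut positions of the sorted image of the first `m` entries of `stackSort π`. -/
def cuts (m : ℕ) (π : List ℕ) : Finset ℕ := cutSet m (stackSort ((stackSort π).take m))

theorem stackSort_length (w : List ℕ) : (stackSort w).length = w.length :=
  (stackSort_perm w).length_eq

theorem perm_of_stackSort_stackSort {τ w : List ℕ} (h : stackSort (stackSort τ) = w) :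
    τ.Perm w := by
  rw [← h]; exact ((stackSort_perm _).trans (stackSort_perm _)).symm

theorem HasTail.perm {m l : ℕ} {π : List ℕ} (h : HasTail m l π) :
    π.Perm (List.range' 1 (m + l)) := by
  obtain ⟨τ, h1, h2⟩ := h
  refine (stackSort_perm π).symm.trans ?_
  rw [h1, ← List.range'_append_1, add_comm 1 m]
  exact (perm_of_stackSort_stackSort h2).append_right _

theorem take_of_eq {m l : ℕ} {π τ : List ℕ} (h1 : stackSort π = τ ++ List.range' (m + 1) l)
    (h2 : stackSort (stackSort τ) = List.range' 1 m) : (stackSort π).take m = τ := by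
  have : τ.length = m := by simpa using (perm_of_stackSort_stackSort h2).length_eq
  rw [h1, ← this, List.take_left]

/-- The relabelling of the first argument of the insertion. -/
def relabelLeft (a j m q x : ℕ) : ℕ :=
  if x < a then x else if x = a then a + j else if x = a + 1 then m else m + q + (x - a)

/-- The relabelling of the second argument of the insertion. -/
def relabelRight (a b j x : ℕ) : ℕ :=
  if x ≤ j then a + x - 1 else if x ≤ b then a + x else a + x + 1

theorem relabelLeft_strictMono {a j m q : ℕ} (h : a + j < m) :
    StrictMono (relabelLeft a j m q) := by
  intro x y hxy
  unfold relabelLeft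
  split_ifs <;> omega

theorem relabelRight_strictMono {a b j : ℕ} (h0 : a = 0 → j = 0) :
    StrictMono (relabelRight a b j) := by
  intro x y hxy
  unfold relabelRight
  split_ifs <;> omega

theorem map_range'_eq {f : ℕ → ℕ} {u v n : ℕ} (h : ∀ i < n, f (u + i) = v + i) :
    (List.range' u n).map f = List.range' v n := by
  apply List.ext_getElem
  · simp
  · intro i h1 h2
    simp at h1 ⊢
    exact h i h1

theorem map_eq_self {f : ℕ → ℕ} {w : List ℕ} (h : ∀ x ∈ w, f x = x) : w.map f = w := by
  conv_rhs => rw [← List.map_id w]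
  exact List.map_congr_left h

/-- The maximum leaves the stack last. This lets the merge below raise the last entry of the left
sorted body. -/
theorem exists_stackSort_eq_append {w : List ℕ} {a : ℕ} (ha : 1 ≤ a)
    (h : w.Perm (List.range' 1 a)) :
    ∃ X, stackSort w = X ++ [a] ∧ ∀ x ∈ X, x < a := by
  obtain ⟨U, V, rfl⟩ := List.append_of_mem (h.mem_iff.2 (by simp; omega) : a ∈ w)
  have hn : (U ++ a :: V).Nodup := h.nodup_iff.2 List.nodup_range'
  have hlt : ∀ x, x ∈ U ∨ x ∈ V → x < a := by
    intro x hx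
    have h1 := h.mem_iff.1 (show x ∈ U ++ a :: V by simp; tauto)
    have h2 : x ≠ a := by
      rintro rfl
      rw [List.nodup_append] at hn
      simp at hn
      rcases hx with hx | hx
      · exact (hn.2.2 _ hx).1 rfl
      · exact hn.2.1.1 hx
    simp at h1; omega
  refine ⟨stackSort U ++ stackSort V,
    stackSort_append_cons (fun x hx => hlt x (Or.inl hx)) (fun x hx => hlt x (Or.inr hx)), ?_⟩
  intro x hx
  refine hlt x ?_
  simpa [(stackSort_perm U).mem_iff, (stackSort_perm V).mem_iff] using hx

/-- By pigeonhole, `j` distinct positive entries that are at most `j` use up all of `1, …, j`. -/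
theorem lt_of_mem_drop {σ : List ℕ} {b j : ℕ} (hσ : σ.Perm (List.range' 1 b)) (hj : j ≤ b)
    (h : ∀ x ∈ σ.take j, x ≤ j) : ∀ x ∈ σ.drop j, j < x := by
  have hn : σ.Nodup := hσ.nodup_iff.2 List.nodup_range'
  have hlen : σ.length = b := by simpa using hσ.length_eq
  have hsub : (σ.take j).toFinset = Icc 1 j := by
    apply Finset.eq_of_subset_of_card_le
    · intro x hx
      simp only [List.mem_toFinset] at hx
      have := hσ.mem_iff.1 (List.mem_of_mem_take hx)
      simp at this
      simp [h x hx]; omega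
    · rw [List.toFinset_card_of_nodup (hn.sublist (List.take_sublist _ _))]
      simp; omega
  intro x hx
  by_contra hlt
  have hx1 := hσ.mem_iff.1 (List.mem_of_mem_drop hx)
  simp at hx1
  have : x ∈ (σ.take j).toFinset := by rw [hsub]; simp; omega
  rw [List.mem_toFinset] at this
  exact List.disjoint_take_drop hn le_rfl this hx

/-! ### Merging two sorted bodies at a cut -/

section merge
variable {a b j m q : ℕ} {σ ρ : List ℕ}

/-- For `a ≥ 1` write `σ = X ++ [a]`. The relabelled word is `X`, then `a + j` followed by the first
`j` entries of `ρ` on the values `a, …, a + j - 1`, then the rest of `ρ` above `a + j`. These three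
blocks increase in value, so they are sorted separately, and within the middle block `a + j` moves
to the end. Since `j` is a cut, the two parts of `ρ` are sortable on their own. -/
theorem stackSort_merge (hm : a + b < m) (hσ : stackSort σ = List.range' 1 a)
    (hσ' : 1 ≤ a → ∃ X, σ = X ++ [a] ∧ ∀ x ∈ X, x < a)
    (hρ : stackSort ρ = List.range' 1 b) (hj : j ≤ b) (h0 : a = 0 → j = 0)
    (hcut : ∀ x ∈ ρ.take j, x ≤ j) :
    stackSort (σ.map (relabelLeft a j m q) ++ ρ.map (relabelRight a b j)) =
      List.range' 1 (a + b) := by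
  have hR : StrictMono (relabelRight a b j) := relabelRight_strictMono h0
  have hρp : ρ.Perm (List.range' 1 b) := by rw [← hρ]; exact (stackSort_perm _).symm
  rcases Nat.eq_zero_or_pos a with ha | ha
  · subst ha
    obtain rfl := h0 rfl
    have : σ = [] := by
      have := congrArg List.length hσ
      simpa [stackSort_length] using this
    subst this
    simp only [List.map_nil, List.nil_append, stackSort_map hR, hρ]
    rw [Nat.zero_add]
    refine map_range'_eq fun i hi => ?_
    unfold relabelRight; split_ifs <;> omega
  obtain ⟨X, rfl, hX⟩ := hσ' ha
  have hhi := lt_of_mem_drop hρp hj hcut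
  have hlen : ρ.length = b := by simpa using hρp.length_eq
  have hsplit : stackSort ρ = stackSort (ρ.take j) ++ stackSort (ρ.drop j) := by
    conv_lhs => rw [← List.take_append_drop j ρ]
    exact stackSort_append fun x hx y hy => (hcut x hx).trans (hhi y hy).le
  have hXs : stackSort X = List.range' 1 (a - 1) := by
    rw [stackSort_append (by simpa using fun x hx => (hX x hx).le)] at hσ
    obtain ⟨c, rfl⟩ : ∃ c, a = c + 1 := ⟨a - 1, by omega⟩
    rw [List.range'_1_concat] at hσ
    simpa using (List.append_inj' hσ (by simp)).1
  have hlohi : stackSort (ρ.take j) = List.range' 1 j ∧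
      stackSort (ρ.drop j) = List.range' (1 + j) (b - j) := by
    apply List.append_inj
    · rw [← hsplit, hρ, List.range'_append_1]; congr 1; omega
    · simp [stackSort_length]; omega
  have hXmap : X.map (relabelLeft a j m q) = X :=
    map_eq_self fun x hx => by unfold relabelLeft; rw [if_pos (hX x hx)]
  have hgl : ∀ x ∈ ρ.take j, relabelRight a b j x < a + j := fun x hx => by
    have := hcut x hx
    unfold relabelRight; split_ifs; omega
  have hgh : ∀ x ∈ ρ.drop j, a + j < relabelRight a b j x := fun x hx => by
    have := hhi x hx
    unfold relabelRight; split_ifs <;> omega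
  have hform : (X ++ [a]).map (relabelLeft a j m q) ++ ρ.map (relabelRight a b j) =
      X ++ (((a + j) :: (ρ.take j).map (relabelRight a b j)) ++
        (ρ.drop j).map (relabelRight a b j)) := by
    rw [List.map_append, hXmap]
    conv_lhs => rw [← List.take_append_drop j ρ]
    simp [relabelLeft]
  rw [hform, stackSort_append, stackSort_append, stackSort_cons, stackSort_map hR,
    stackSort_map hR, hlohi.1, hlohi.2, hXs,
    map_range'_eq (v := a), map_range'_eq (v := a + j + 1)]
  · have e1 : List.range' a j ++ [a + j] = List.range' a (j + 1) := (List.range'_1_concat).symm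
    have e2 : List.range' a (j + 1) ++ List.range' (a + j + 1) (b - j) =
      List.range' a (b + 1) := by
      rw [add_assoc, List.range'_append_1]; congr 1; omega
    rw [e1, e2]
    conv_lhs => rw [show a = 1 + (a - 1) by omega, Nat.add_sub_cancel_left,
      List.range'_append_1]
    congr 1; omega
  · intro i hi; unfold relabelRight; split_ifs <;> omega
  · intro i hi; unfold relabelRight; split_ifs <;> omega
  · intro x hx
    obtain ⟨z, hz, rfl⟩ := List.mem_map.1 hx
    exact hgl z hz
  · intro x hx y hy
    simp only [List.mem_cons, List.mem_map] at hx hy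
    obtain ⟨y, hy, rfl⟩ := hy
    have h1 := hgh y hy
    rcases hx with rfl | ⟨x, hx, rfl⟩
    · exact h1.le
    · exact ((hgl x hx).trans h1).le
  · intro x hx y hy
    have h1 := hX x hx
    simp only [List.mem_append, List.mem_cons, List.mem_map] at hy
    rcases hy with (rfl | ⟨y, hy, rfl⟩) | ⟨y, hy, rfl⟩
    · omega
    · have : 1 ≤ y := by
        have := hρp.mem_iff.1 (List.mem_of_mem_take hy)
        simp at this; omega
      unfold relabelRight; split_ifs <;> omega
    · have := hgh y hy; omega

/-- Cuts of `σ` below `a` survive and the cut `a` moves to `a + j`; cuts of `ρ` beyond `j` are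
shifted by `a`; and `m` is a new cut. The three families lie in successive ranges of positions,
hence are disjoint. -/
theorem cutSet_merge (hm : m = a + b + 1)
    (hσp : σ.Perm (List.range' 1 a))
    (hσ' : 1 ≤ a → ∃ X, σ = X ++ [a] ∧ ∀ x ∈ X, x < a)
    (hρp : ρ.Perm (List.range' 1 b)) (hj : j ≤ b)
    (hcut : ∀ x ∈ ρ.take j, x ≤ j) :
    (cutSet a σ).card + ((cutSet b ρ).filter (j < ·)).card + 1 ≤
      (cutSet m (σ.map (relabelLeft a j m q) ++ ρ.map (relabelRight a b j) ++ [m])).card := by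
  have hσl : σ.length = a := by simpa using hσp.length_eq
  have hρl : ρ.length = b := by simpa using hρp.length_eq
  have hL : StrictMono (relabelLeft a j m q) := relabelLeft_strictMono (by omega)
  set φ : ℕ → ℕ := relabelLeft a j m q with hφ
  have hφle : ∀ x ≤ a, φ x ≤ a + j := fun x hx => by
    simp only [hφ, relabelLeft]; split_ifs <;> omega
  have hgle : ∀ x ≤ b, relabelRight a b j x ≤ a + x := fun x hx => by
    unfold relabelRight; split_ifs <;> omega
  have hσm : ∀ x ∈ σ, 1 ≤ x ∧ x ≤ a := fun x hx => by
    have := hσp.mem_iff.1 hx; simp at this; omega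
  have hρm : ∀ x ∈ ρ, 1 ≤ x ∧ x ≤ b := fun x hx => by
    have := hρp.mem_iff.1 hx; simp at this; omega
  have key : (cutSet a σ).image φ ∪ ((cutSet b ρ).filter (j < ·)).image (a + ·) ∪ {m} ⊆
      cutSet m (σ.map φ ++ ρ.map (relabelRight a b j) ++ [m]) := by
    intro k hk
    simp only [mem_union, mem_image, mem_filter, mem_singleton, mem_cutSet] at hk
    rw [mem_cutSet]
    rcases hk with (⟨x, ⟨⟨hx1, hxa⟩, hx⟩, rfl⟩ | ⟨x, ⟨⟨⟨hx1, hxb⟩, hx⟩, hjx⟩, rfl⟩) | rfl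
    · rcases hxa.lt_or_eq with hlt | rfl
      · have hφx : φ x = x := by simp [hφ, relabelLeft, hlt]
        rw [hφx]
        refine ⟨by omega, fun y hy => ?_⟩
        rw [List.append_assoc, List.take_append_of_le_length (by simp; omega),
          ← List.map_take] at hy
        obtain ⟨z, hz, rfl⟩ := List.mem_map.1 hy
        have := hx z hz
        simp only [hφ, relabelLeft]; split_ifs <;> omega
      · have hφx : φ x = x + j := by simp [hφ, relabelLeft]
        rw [hφx]
        refine ⟨by omega, fun y hy => ?_⟩
        rw [List.append_assoc, List.take_append, List.take_append, List.mem_append,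
          List.mem_append] at hy
        rcases hy with hy | hy | hy
        · obtain ⟨z, hz, rfl⟩ := List.mem_map.1 (List.mem_of_mem_take hy)
          exact hφle z (hσm z hz).2
        · simp only [List.length_map, hσl, Nat.add_sub_cancel_left, ← List.map_take] at hy
          obtain ⟨z, hz, rfl⟩ := List.mem_map.1 hy
          have h1 := hcut z hz
          have := hgle z (by omega)
          omega
        · simp only [List.length_map, hσl, hρl] at hy
          rw [show x + j - x - b = 0 by omega] at hy
          simp at hy
    · refine ⟨by omega, fun y hy => ?_⟩
      rw [List.append_assoc, List.take_append, List.take_append, List.mem_append,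
        List.mem_append] at hy
      rcases hy with hy | hy | hy
      · obtain ⟨z, hz, rfl⟩ := List.mem_map.1 (List.mem_of_mem_take hy)
        have := hφle z (hσm z hz).2
        omega
      · simp only [List.length_map, hσl, Nat.add_sub_cancel_left, ← List.map_take] at hy
        obtain ⟨z, hz, rfl⟩ := List.mem_map.1 hy
        have h1 := hx z hz
        have := hgle z (by omega)
        omega
      · simp only [List.length_map, hσl, hρl] at hy
        rw [show a + x - a - b = 0 by omega] at hy
        simp at hy
    · refine ⟨by omega, fun y hy => ?_⟩
      have hy := List.mem_of_mem_take hy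
      simp only [List.mem_append, List.mem_map, List.mem_singleton] at hy
      rcases hy with (⟨z, hz, rfl⟩ | ⟨z, hz, rfl⟩) | rfl
      · have := hφle z (hσm z hz).2; omega
      · have := hgle z (hρm z hz).2; have := hρm z hz; omega
      · rfl
  refine le_trans (le_of_eq ?_) (card_le_card key)
  rw [card_union_of_disjoint, card_union_of_disjoint, card_image_of_injective _ hL.injective,
    card_image_of_injective _ (add_right_injective a), card_singleton]
  · rw [disjoint_left]
    intro k hk hk'
    simp only [mem_image, mem_filter, mem_cutSet] at hk hk'
    obtain ⟨x, hx, rfl⟩ := hk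
    obtain ⟨y, hy, hxy⟩ := hk'
    have := hφle x hx.1.2
    omega
  · rw [disjoint_singleton_right]
    intro hk
    simp only [mem_union, mem_image, mem_filter, mem_cutSet] at hk
    rcases hk with ⟨x, hx, h⟩ | ⟨x, hx, h⟩
    · have := hφle x hx.1.2; omega
    · omega
end merge

/-! ### The two constructions: absorbing a tail value, and insertion -/

/-- The permutation is unchanged; only the border between body and tail moves. Appending its new
maximum keeps the body 2-stack-sortable, keeps all cuts and adds the cut `m + 1`. The last clause,
that the body maximum comes last, tells this construction from insertion. -/
theorem HasTail.append_shift {m l : ℕ} {π : List ℕ} (h : HasTail m (l + 1) π) :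
    HasTail (m + 1) l π ∧ (cuts m π).card + 1 ≤ (cuts (m + 1) π).card ∧
      (stackSort π)[m]? = some (m + 1) := by
  obtain ⟨τ, h1, h2⟩ := h
  have hτ := perm_of_stackSort_stackSort h2
  have hlen : τ.length = m := by simpa using hτ.length_eq
  have hmem : ∀ x ∈ τ, x ≤ m := fun x hx => by
    have := hτ.mem_iff.1 hx; simp at this; omega
  have hmem' : ∀ x ∈ stackSort τ, x ≤ m := fun x hx => hmem x ((stackSort_perm τ).mem_iff.1 hx)
  have h1' : stackSort π = (τ ++ [m + 1]) ++ List.range' (m + 1 + 1) l := by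
    rw [h1, List.range'_succ]; simp
  have hs : stackSort (τ ++ [m + 1]) = stackSort τ ++ [m + 1] := by
    rw [stackSort_append (by simpa using fun x hx => (hmem x hx).trans m.le_succ),
      stackSort_singleton]
  have h2' : stackSort (stackSort (τ ++ [m + 1])) = List.range' 1 (m + 1) := by
    rw [hs, stackSort_append (by simpa using fun x hx => (hmem' x hx).trans m.le_succ),
      stackSort_singleton, h2, List.range'_1_concat, add_comm]
  refine ⟨⟨_, h1', h2'⟩, ?_, ?_⟩
  · unfold cuts
    rw [take_of_eq h1' h2', take_of_eq h1 h2, hs,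
      ← card_insert_of_notMem (s := cutSet m (stackSort τ)) (a := m + 1)
        (by simp [mem_cutSet])]
    refine card_le_card fun k hk => ?_
    rw [mem_insert, mem_cutSet] at hk
    rw [mem_cutSet]
    have hlen' : (stackSort τ).length = m := by rw [stackSort_length, hlen]
    rcases hk with rfl | ⟨hk, hx⟩
    · refine ⟨by omega, fun x hx => ?_⟩
      have := List.mem_of_mem_take hx
      simp only [List.mem_append, List.mem_singleton] at this
      rcases this with h | h
      · have := hmem' x h; omega
      · omega
    · refine ⟨by omega, fun x hx' => hx x ?_⟩
      rwa [List.take_append_of_le_length (by omega)] at hx'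
  · rw [h1, List.getElem?_append_right (by omega), hlen]; simp [List.range'_succ]

/-- Insert `w`, relabelled and preceded by a new entry, into the relabelled list `v`, right
before the first entry after `a + 1` that exceeds it. -/
def insertAt (a b j q : ℕ) (v w : List ℕ) : List ℕ :=
  let f := relabelLeft a j (a + b + 1) q
  let r := (v.dropWhile (· ≠ a + 1)).tail
  (v.takeWhile (· ≠ a + 1)).map f ++ (a + b + 1) :: ((r.takeWhile (· < a + 1)).map f ++
    (a + b + 1 + q + 1) :: (w.map (relabelRight a b j) ++ (r.dropWhile (· < a + 1)).map f))

theorem takeWhile_of_split {p : ℕ → Bool} {u v : List ℕ} (hu : ∀ x ∈ u, p x)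
    (hv : ∀ x ∈ v.head?, ¬ p x) : (u ++ v).takeWhile p = u ∧ (u ++ v).dropWhile p = v := by
  have h1 : v.takeWhile p = [] := by
    cases v <;> simp_all
  have h2 : v.dropWhile p = v := by
    cases v <;> simp_all
  refine ⟨by rw [List.takeWhile_append_of_pos hu, h1, List.append_nil],
    by rw [List.dropWhile_append_of_pos hu, h2]⟩

theorem split_inj {p : ℕ → Bool} {u v u' v' : List ℕ} (h : u ++ v = u' ++ v')
    (hu : ∀ x ∈ u, p x) (hv : ∀ x ∈ v.head?, ¬ p x)
    (hu' : ∀ x ∈ u', p x) (hv' : ∀ x ∈ v'.head?, ¬ p x) : u = u' ∧ v = v' := by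
  have h1 := takeWhile_of_split hu hv
  have h2 := takeWhile_of_split hu' hv'
  rw [h] at h1
  exact ⟨h1.1.symm.trans h2.1, h1.2.symm.trans h2.2⟩

/-- The admissible arguments of `insertAt`. -/
structure Insertable (a b p q j : ℕ) (v w : List ℕ) : Prop where
  left : HasTail a p v
  right : HasTail b q w
  pos_left : 1 ≤ p
  pos_right : 1 ≤ b
  le : j ≤ b
  -- With an empty left body there is no maximum to raise to `a + j`, so only the trivial
  -- interleaving exists.
  zero : a = 0 → j = 0
  cut : j = 0 ∨ j ∈ cuts b w

theorem exists_split {v : List ℕ} {a : ℕ} (hn : v.Nodup) (ha : a + 1 ∈ v) :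
    ∃ P Q R, v = P ++ (a + 1) :: (Q ++ R) ∧ (∀ x ∈ P, x ≠ a + 1) ∧
      (∀ x ∈ Q, x < a + 1) ∧ (∀ x ∈ R, x ≠ a + 1) ∧ (∀ x ∈ R.head?, a + 1 < x) ∧
      v.takeWhile (· ≠ a + 1) = P ∧ (v.dropWhile (· ≠ a + 1)).tail.takeWhile (· < a + 1) = Q ∧
      (v.dropWhile (· ≠ a + 1)).tail.dropWhile (· < a + 1) = R := by
  obtain ⟨P, r, rfl⟩ := List.append_of_mem ha
  have hn' := hn
  rw [List.nodup_append, List.nodup_cons] at hn'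
  have hP : ∀ x ∈ P, x ≠ a + 1 := fun x hx => hn'.2.2 x hx (a + 1) (by simp)
  have hr : ∀ x ∈ r, x ≠ a + 1 := fun x hx hxa => hn'.2.1.1 (hxa ▸ hx)
  have h1 := takeWhile_of_split (p := fun x => decide (x ≠ a + 1)) (u := P) (v := (a + 1) :: r)
    (by simpa using hP) (by simp)
  have hmem : ∀ x ∈ r.dropWhile (· < a + 1), x ∈ r := fun x hx =>
    (List.dropWhile_sublist _).subset hx
  refine ⟨P, r.takeWhile (· < a + 1), r.dropWhile (· < a + 1), ?_, hP, ?_, ?_, ?_, h1.1, ?_, ?_⟩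
  · rw [List.takeWhile_append_dropWhile]
  · intro x hx; simpa using List.mem_takeWhile_imp hx
  · exact fun x hx => hr x (hmem x hx)
  · intro x hx
    have h2 := hr x (hmem x (List.mem_of_mem_head? hx))
    have h3 := List.head?_dropWhile_not (fun x => decide (x < a + 1)) r
    rw [Option.mem_def] at hx
    rw [hx] at h3
    simp at h3; omega
  · rw [h1.2, List.tail_cons]
  · rw [h1.2, List.tail_cons]

/-- Provides the hypotheses of `stackRun_insert`, with `m = a + b + 1` and `t = m + q + 1`: the
relabelling leaves the whole range from `m` to `t` free except for the image `m` of `a + 1`. -/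
theorem Insertable.exists_form {a b p q j : ℕ} {v w : List ℕ} (h : Insertable a b p q j v w) :
    ∃ P Q R, v = P ++ (a + 1) :: (Q ++ R) ∧
      (∀ x ∈ P.map (relabelLeft a j (a + b + 1) q), x < a + b + 1 ∨ a + b + 1 + q + 1 < x) ∧
      (∀ x ∈ Q.map (relabelLeft a j (a + b + 1) q), x < a + b + 1) ∧
      (∀ x ∈ R.map (relabelLeft a j (a + b + 1) q), x < a + b + 1 ∨ a + b + 1 + q + 1 < x) ∧
      (∀ x ∈ (R.map (relabelLeft a j (a + b + 1) q)).head?, a + b + 1 + q + 1 < x) ∧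
      (∀ x ∈ w.map (relabelRight a b j), x < a + b + 1 + q + 1) ∧
      insertAt a b j q v w = P.map (relabelLeft a j (a + b + 1) q) ++ (a + b + 1) ::
        (Q.map (relabelLeft a j (a + b + 1) q) ++ (a + b + 1 + q + 1) ::
        (w.map (relabelRight a b j) ++ R.map (relabelLeft a j (a + b + 1) q))) := by
  have hv := h.left.perm
  have hw := h.right.perm
  have h1 := h.pos_left
  have h2 := h.le
  have hbig : ∀ x ≠ a + 1, relabelLeft a j (a + b + 1) q x < a + b + 1 ∨
      a + b + 1 + q + 1 < relabelLeft a j (a + b + 1) q x := fun x hx => by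
    unfold relabelLeft; split_ifs <;> omega
  obtain ⟨P, Q, R, hvf, hP, hQ, hR, hRh, e1, e2, e3⟩ :=
    exists_split (hv.nodup_iff.2 List.nodup_range') (hv.mem_iff.2 (by simp; omega) : a + 1 ∈ v)
  refine ⟨P, Q, R, hvf, ?_, ?_, ?_, ?_, ?_, ?_⟩
  · simpa using fun x hx => hbig x (hP x hx)
  · intro x hx
    obtain ⟨y, hy, rfl⟩ := List.mem_map.1 hx
    have := hQ y hy
    unfold relabelLeft; split_ifs <;> omega
  · simpa using fun x hx => hbig x (hR x hx)
  · intro x hx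
    rw [List.head?_map] at hx
    obtain ⟨y, hy, rfl⟩ := Option.mem_map.1 hx
    have := hRh y hy
    unfold relabelLeft; split_ifs <;> omega
  · intro x hx
    obtain ⟨y, hy, rfl⟩ := List.mem_map.1 hx
    have := hw.mem_iff.1 hy
    simp at this
    unfold relabelRight; split_ifs <;> omega
  · unfold insertAt
    simp only [e1, e2, e3]

/-- The tail is assembled from the `q` tail values of `w`, the new entry, and the remaining `p - 1`
tail values of `v`; the first tail value of `v` has become the body maximum. -/
theorem Insertable.stackSort_insertAt {a b p q j : ℕ} {v w : List ℕ}
    (h : Insertable a b p q j v w) :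
    stackSort (insertAt a b j q v w) =
      (((stackSort v).take a).map (relabelLeft a j (a + b + 1) q) ++ (a + b + 1) ::
        ((stackSort w).take b).map (relabelRight a b j)) ++
      List.range' (a + b + 1 + 1) (p + q) := by
  obtain ⟨P, Q, R, hvf, hP, hQ, hR, hRh, hw, he⟩ := h.exists_form
  have hj := h.le
  have hL : StrictMono (relabelLeft a j (a + b + 1) q) := relabelLeft_strictMono (by omega)
  have hRm : StrictMono (relabelRight a b j) := relabelRight_strictMono h.zero
  obtain ⟨A, hA1, hA2⟩ := h.left
  obtain ⟨B, hB1, hB2⟩ := h.right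
  obtain ⟨p, rfl⟩ : ∃ c, p = c + 1 := ⟨p - 1, by have := h.pos_left; omega⟩
  obtain ⟨U, V, h1, h2⟩ := stackRun_insert (S := []) hQ
    (fun x hx => lt_trans (by omega) (hRh x hx)) (by omega) hw
    (by
      rintro x (hx | hx | hx)
      · exact hP x hx
      · exact hR x hx
      · simp at hx)
  have hL1 : relabelLeft a j (a + b + 1) q (a + 1) = a + b + 1 := by
    simp [relabelLeft]
  have hv : stackSort (v.map (relabelLeft a j (a + b + 1) q)) = U ++ (a + b + 1) :: V := by
    rw [← h1, hvf, stackSort]; simp [hL1]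
  rw [stackSort_map hL, hA1, List.range'_succ] at hv
  have hAm : ∀ x ∈ A, x ≠ a + 1 := fun x hx => by
    have := (perm_of_stackSort_stackSort hA2).mem_iff.1 hx
    simp at this; omega
  have hnd : (U ++ (a + b + 1) :: V).Nodup := by
    rw [← hv, List.nodup_map_iff hL.injective, ← List.range'_succ, ← hA1]
    exact ((stackSort_perm _).trans h.left.perm).nodup_iff.2 List.nodup_range'
  rw [List.nodup_append] at hnd
  rw [List.map_append, List.map_cons, hL1] at hv
  obtain ⟨hU, hV⟩ := split_inj (p := fun x => decide (x ≠ a + b + 1)) hv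
    (by
      intro x hx
      obtain ⟨y, hy, rfl⟩ := List.mem_map.1 hx
      rw [decide_eq_true_eq]
      exact fun hc => hAm y hy (hL.injective (hc.trans hL1.symm))) (by simp)
    (by simpa using fun x hx => hnd.2.2 x hx (a + b + 1) (by simp)) (by simp)
  rw [List.cons.injEq] at hV
  rw [take_of_eq hA1 hA2, take_of_eq hB1 hB2, he]
  unfold stackSort at *
  rw [h2, ← hU, ← hV.2]
  have hsw := stackSort_map hRm w
  unfold stackSort at hsw
  rw [hsw, hB1, List.map_append, map_range'_eq (v := a + b + 1 + 1),
    map_range'_eq (v := a + b + 1 + q + 1 + 1)]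
  · simp only [List.append_assoc, List.cons_append, List.append_cancel_left_eq,
      List.cons.injEq, true_and]
    rw [show p + 1 + q = q + (p + 1) by omega, ← List.range'_append_1, List.range'_succ (n := p)]
    rw [show a + b + 1 + 1 + q = a + b + 1 + q + 1 by omega]
  · intro i hi; unfold relabelLeft; split_ifs <;> omega
  · intro i hi; unfold relabelRight; split_ifs <;> omega

theorem Insertable.hasTail {a b p q j : ℕ} {v w : List ℕ} (h : Insertable a b p q j v w) :
    HasTail (a + b + 1) (p + q) (insertAt a b j q v w) ∧
      (cuts a v).card + ((cuts b w).filter (j < ·)).card + 1 ≤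
        (cuts (a + b + 1) (insertAt a b j q v w)).card := by
  have hs := h.stackSort_insertAt
  obtain ⟨A, hA1, hA2⟩ := h.left
  obtain ⟨B, hB1, hB2⟩ := h.right
  have hj := h.le
  have hL : StrictMono (relabelLeft a j (a + b + 1) q) := relabelLeft_strictMono (by omega)
  have hRm : StrictMono (relabelRight a b j) := relabelRight_strictMono h.zero
  have hAp := perm_of_stackSort_stackSort hA2
  have hBp := perm_of_stackSort_stackSort hB2
  have hcut : ∀ x ∈ (stackSort B).take j, x ≤ j := by
    rcases h.cut with rfl | hc
    · simp
    · rw [cuts, mem_cutSet, take_of_eq hB1 hB2] at hc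
      exact hc.2
  rw [take_of_eq hA1 hA2, take_of_eq hB1 hB2] at hs
  have hlt : (∀ x ∈ A.map (relabelLeft a j (a + b + 1) q), x < a + b + 1) ∧
      (∀ x ∈ B.map (relabelRight a b j), x < a + b + 1) := by
    constructor
    · intro x hx
      obtain ⟨y, hy, rfl⟩ := List.mem_map.1 hx
      have := hAp.mem_iff.1 hy
      simp at this
      unfold relabelLeft; split_ifs <;> omega
    · intro x hx
      obtain ⟨y, hy, rfl⟩ := List.mem_map.1 hx
      have := hBp.mem_iff.1 hy
      simp at this
      unfold relabelRight; split_ifs <;> omega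
  -- Sorting the new body once puts its maximum last and the two sorted halves side by side, which
  -- is the word treated by `stackSort_merge`.
  have hs1 := stackSort_append_cons hlt.1 hlt.2
  rw [stackSort_map hL, stackSort_map hRm] at hs1
  have hmerge := stackSort_merge (m := a + b + 1) (q := q) (by omega) hA2
    (fun ha => exists_stackSort_eq_append ha hAp) hB2 hj h.zero hcut
  have hs2 : stackSort (stackSort (A.map (relabelLeft a j (a + b + 1) q) ++
      (a + b + 1) :: B.map (relabelRight a b j))) = List.range' 1 (a + b + 1) := by
    rw [hs1, stackSort_append, hmerge, stackSort_singleton, List.range'_1_concat]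
    · simp; omega
    · intro x hx y hy
      simp only [List.mem_singleton] at hy
      subst hy
      rw [← stackSort_map hL, ← stackSort_map hRm, List.mem_append,
        (stackSort_perm _).mem_iff, (stackSort_perm _).mem_iff] at hx
      exact (hx.elim (hlt.1 x) (hlt.2 x)).le
  refine ⟨⟨_, hs, hs2⟩, ?_⟩
  unfold cuts
  rw [take_of_eq hs hs2, take_of_eq hA1 hA2, take_of_eq hB1 hB2, hs1]
  exact cutSet_merge rfl ((stackSort_perm _).trans hAp)
    (fun ha => exists_stackSort_eq_append ha hAp) ((stackSort_perm _).trans hBp) hj hcut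

/-- The position of the body maximum in the sorted image gives `a`. In the unsorted word, the first
larger entry after this maximum is `a + b + 1 + q + 1`, giving `q`; the entries below it that follow
are the image of `w`, and what remains is the image of `v`. -/
theorem Insertable.inj {a b p q j : ℕ} {v w : List ℕ} (h : Insertable a b p q j v w)
    {a' b' p' q' j' : ℕ} {v' w' : List ℕ} (h' : Insertable a' b' p' q' j' v' w')
    (hm : a + b = a' + b') (hl : p + q = p' + q')
    (he : insertAt a b j q v w = insertAt a' b' j' q' v' w') :
    a = a' ∧ b = b' ∧ p = p' ∧ q = q' ∧ j = j' ∧ v = v' ∧ w = w' := by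
  have hs := h.stackSort_insertAt
  have hs' := h'.stackSort_insertAt
  obtain ⟨P, Q, R, hvf, hP, hQ, hR, hRh, hw, hf⟩ := h.exists_form
  obtain ⟨P', Q', R', hvf', hP', hQ', hR', hRh', hw', hf'⟩ := h'.exists_form
  have key : ∀ {a b p q j : ℕ} {v w : List ℕ} (_ : Insertable a b p q j v w),
      (∀ x ∈ ((stackSort v).take a).map (relabelLeft a j (a + b + 1) q), x ≠ a + b + 1) ∧
      ((stackSort v).take a).length = a := by
    intro a b p q j v w h
    obtain ⟨A, hA1, hA2⟩ := h.left
    have hAp := perm_of_stackSort_stackSort hA2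
    have hj := h.le
    rw [take_of_eq hA1 hA2]
    refine ⟨?_, by simpa using hAp.length_eq⟩
    intro x hx
    obtain ⟨y, hy, rfl⟩ := List.mem_map.1 hx
    have := hAp.mem_iff.1 hy
    simp at this
    unfold relabelLeft; split_ifs <;> omega
  have ha : a = a' := by
    rw [he, hs', ← hm] at hs
    simp only [List.append_assoc, List.cons_append] at hs
    have := (split_inj (p := fun x => decide (x ≠ a + b + 1)) hs.symm
      (by simpa using (key h).1) (by simp)
      (by have := (key h').1; rw [← hm] at this; simpa using this) (by simp)).1
    have := congrArg List.length this
    simpa only [List.length_map, (key h).2, (key h').2] using this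
  subst ha
  obtain rfl : b = b' := by omega
  rw [hf, hf'] at he
  obtain ⟨e1, e2⟩ := split_inj (p := fun x => decide (x ≠ a + b + 1)) he
    (by intro x hx; have := hP x hx; simp; omega) (by simp)
    (by intro x hx; have := hP' x hx; simp; omega) (by simp)
  rw [List.cons.injEq] at e2
  obtain ⟨e2, e3⟩ := split_inj (p := fun x => decide (x < a + b + 1)) e2.2
    (by simpa using hQ) (by simp; omega) (by simpa using hQ') (by simp; omega)
  rw [List.cons.injEq] at e3
  obtain rfl : q = q' := by omega
  obtain rfl : p = p' := by omega
  obtain ⟨e3, e4⟩ := split_inj (p := fun x => decide (x < a + b + 1 + q + 1)) e3.2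
    (by simpa using hw) (fun x hx => by have := hRh x hx; simp; omega) (by simpa using hw')
    (fun x hx => by have := hRh' x hx; simp; omega)
  have hL1 : ∀ j, relabelLeft a j (a + b + 1) q (a + 1) = a + b + 1 := by
    simp [relabelLeft]
  have hv : v.map (relabelLeft a j (a + b + 1) q) = v'.map (relabelLeft a j' (a + b + 1) q) := by
    rw [hvf, hvf']
    simp only [List.map_append, List.map_cons, hL1, e1, e2, e4]
  have hjb := h.le
  -- For `a > 0`, the only value of the relabelled `v` in `[a, a + b]` is `a + j`.
  obtain rfl : j = j' := by
    rcases Nat.eq_zero_or_pos a with h0 | h0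
    · rw [h.zero h0, h'.zero h0]
    · have : a + j ∈ v.map (relabelLeft a j (a + b + 1) q) := by
        refine List.mem_map.2 ⟨a, h.left.perm.mem_iff.2 (by simp; omega), by simp [relabelLeft]⟩
      rw [hv] at this
      obtain ⟨x, -, hx⟩ := List.mem_map.1 this
      unfold relabelLeft at hx
      split_ifs at hx <;> omega
  refine ⟨rfl, rfl, rfl, rfl, rfl, ?_, ?_⟩
  · exact List.map_injective_iff.2 (relabelLeft_strictMono (by omega)).injective hv
  · exact List.map_injective_iff.2 (relabelRight_strictMono h.zero).injective e3

/-- The body maximum sits at index `a`, not at the last index `a + b`, because `1 ≤ b`. Hence no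
insertion coincides with an absorbed tail value. -/
theorem Insertable.getElem_ne {a b p q j : ℕ} {v w : List ℕ} (h : Insertable a b p q j v w) :
    (stackSort (insertAt a b j q v w))[a + b]? ≠ some (a + b + 1) := by
  intro hc
  have hn : (stackSort (insertAt a b j q v w)).Nodup :=
    ((stackSort_perm _).trans h.hasTail.1.perm).nodup_iff.2 List.nodup_range'
  have hs := h.stackSort_insertAt
  obtain ⟨A, hA1, hA2⟩ := h.left
  have hlen : A.length = a := by simpa using (perm_of_stackSort_stackSort hA2).length_eq
  have hm : (stackSort (insertAt a b j q v w))[a]? = some (a + b + 1) := by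
    rw [hs, take_of_eq hA1 hA2, List.append_assoc, List.getElem?_append_right (by simp [hlen])]
    simp [hlen]
  have hlt : a < (stackSort (insertAt a b j q v w)).length := by
    by_contra hlt
    rw [List.getElem?_eq_none (by omega)] at hm
    simp at hm
  have := (List.getElem?_inj hlt hn).1 (hm.trans hc.symm)
  have := h.pos_right
  omega

/-! ### Generating functions and the recursive inequality -/

open scoped ENNReal

/-- Moving `j` from `0` up through the elements of `S` lowers the count by one at each move. It is
used to choose a cut with exactly `d` cuts beyond it. -/
theorem exists_card_filter_lt {S : Finset ℕ} (hS : ∀ x ∈ S, 1 ≤ x) {d : ℕ} (hd : d ≤ S.card) :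
    ∃ j, (j = 0 ∨ j ∈ S) ∧ (S.filter (j < ·)).card = d := by
  obtain ⟨e, he⟩ : ∃ e, S.card = d + e := ⟨S.card - d, by omega⟩
  induction e generalizing d with
  | zero =>
    exact ⟨0, Or.inl rfl, by rw [filter_true_of_mem (p := (0 < ·)) fun x hx => hS x hx]; omega⟩
  | succ e ih =>
    obtain ⟨j, -, hj⟩ := ih (d := d + 1) (by omega) (by omega)
    have hne : (S.filter (j < ·)).Nonempty := card_pos.1 (by omega)
    have hmem := min'_mem _ hne
    refine ⟨_, Or.inr (mem_filter.1 hmem).1, ?_⟩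
    have : S.filter ((S.filter (j < ·)).min' hne < ·) =
        (S.filter (j < ·)).erase ((S.filter (j < ·)).min' hne) := by
      ext x
      simp only [mem_filter, mem_erase]
      constructor
      · rintro ⟨hx, hlt⟩
        exact ⟨hlt.ne', hx, (mem_filter.1 hmem).2.trans hlt⟩
      · rintro ⟨hx, hxS, hlt⟩
        exact ⟨hxS, lt_of_le_of_ne (min'_le _ _ (mem_filter.2 ⟨hxS, hlt⟩)) (Ne.symm hx)⟩
    rw [this, card_erase_of_mem hmem]
    omega

/-- Pairs `(m, π)`, where `stackSort π` has a tail of length `l` and at least `c` cuts. -/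
def tailSet (c l : ℕ) : Set (ℕ × List ℕ) :=
  {x | 1 ≤ x.1 ∧ HasTail x.1 l x.2 ∧ c ≤ (cuts x.1 x.2).card}

/-- The preimages of the increasing permutation of length `l`. -/
def pureSet (l : ℕ) : Set (List ℕ) := {π | HasTail 0 l π}

/-- The generating function of `tailSet c l` at `y`. -/
noncomputable def tailSum (y : ℝ≥0∞) (c l : ℕ) : ℝ≥0∞ := ∑' x : tailSet c l, y ^ x.1.1

noncomputable def pureCount (l : ℕ) : ℝ≥0∞ := ∑' _ : pureSet l, 1

theorem sum_tsum_le_of_injective {ι T : Type*} [Fintype ι] {A : ι → Type*}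
    (F : ∀ i, A i → T) (hF : Function.Injective fun z : Σ i, A i => F z.1 z.2) (w : T → ℝ≥0∞) :
    ∑ i, ∑' x, w (F i x) ≤ ∑' t, w t := by
  rw [← tsum_fintype (L := .unconditional ι), ← ENNReal.tsum_sigma' fun z : Σ i, A i => w (F z.1 z.2)]
  exact ENNReal.tsum_comp_le_tsum_of_injective hF w

theorem tsum_prod_mul {A B : Type*} (f : A → ℝ≥0∞) (g : B → ℝ≥0∞) :
    ∑' x : A × B, f x.1 * g x.2 = (∑' a, f a) * ∑' b, g b := by
  rw [ENNReal.tsum_prod']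
  simp only [ENNReal.tsum_mul_left, ENNReal.tsum_mul_right]

theorem hasTail_zero_iff {l : ℕ} {π : List ℕ} :
    HasTail 0 l π ↔ stackSort π = List.range' 1 l := by
  constructor
  · rintro ⟨τ, h1, h2⟩
    have := (perm_of_stackSort_stackSort h2).eq_nil
    subst this
    simpa using h1
  · intro h
    exact ⟨[], by simpa using h, by simp⟩

theorem stackSort_glue {i l : ℕ} {u v : List ℕ} (hu : HasTail 0 i u) (hv : HasTail 0 l v) :
    HasTail 0 (i + l + 1) (u ++ (i + l + 1) :: v.map (i + ·)) := by
  have hum := hu.perm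
  have hvm := hv.perm
  rw [hasTail_zero_iff] at *
  have h1 : ∀ x ∈ u, x < i + l + 1 := fun x hx => by
    have := hum.mem_iff.1 hx; simp at this; omega
  have h2 : ∀ x ∈ v.map (i + ·), x < i + l + 1 := fun x hx => by
    obtain ⟨y, hy, rfl⟩ := List.mem_map.1 hx
    have := hvm.mem_iff.1 hy; simp at this; omega
  rw [stackSort_append_cons h1 h2, stackSort_map (fun a b h => by simpa using h), hu, hv,
    map_range'_eq (v := 1 + i) (fun k hk => by omega), List.range'_append_1,
    List.range'_1_concat]
  congr 2; omega

/-- The Catalan recursion as an inequality: split at the maximum, with the smaller values on its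
left. -/
theorem pureCount_succ_ge (l : ℕ) :
    ∑ x ∈ antidiagonal l, pureCount x.1 * pureCount x.2 ≤ pureCount (l + 1) := by
  rw [← Finset.sum_coe_sort]
  unfold pureCount
  simp only [← tsum_prod_mul, one_mul]
  refine sum_tsum_le_of_injective (ι := antidiagonal l)
    (fun i x => (⟨x.1.1 ++ (l + 1) :: x.2.1.map (i.1.1 + ·), ?_⟩ : pureSet (l + 1))) ?_ fun _ => 1
  · have := stackSort_glue x.1.2 x.2.2
    rwa [HasAntidiagonal.mem_antidiagonal.1 i.2] at this
  · rintro ⟨⟨⟨i, j⟩, h⟩, ⟨⟨u, hu⟩, ⟨v, hv⟩⟩⟩ ⟨⟨⟨i', j'⟩, h'⟩, ⟨⟨u', hu'⟩, ⟨v', hv'⟩⟩⟩ he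
    replace he := congrArg Subtype.val he
    change u ++ (l + 1) :: v.map (i + ·) = u' ++ (l + 1) :: v'.map (i' + ·) at he
    change u ∈ pureSet i at hu
    change u' ∈ pureSet i' at hu'
    rw [HasAntidiagonal.mem_antidiagonal] at h h'
    simp only at h h'
    have hne : ∀ {i w}, i ≤ l → w ∈ pureSet i → ∀ x ∈ w, x ≠ l + 1 := fun {i w} hi hw x hx => by
      have := (HasTail.perm hw).mem_iff.1 hx
      simp at this; omega
    obtain ⟨e1, e2⟩ := split_inj (p := fun x => decide (x ≠ l + 1)) he
      (by simpa using hne (by omega) hu) (by simp) (by simpa using hne (by omega) hu') (by simp)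
    subst e1
    obtain rfl : i = i' := by
      have h1 := (HasTail.perm hu).length_eq
      have h2 := (HasTail.perm hu').length_eq
      simp at h1 h2; omega
    obtain rfl : j = j' := by omega
    rw [List.cons.injEq] at e2
    have := List.map_injective_iff.2 (add_right_injective i) e2.2
    subst this
    rfl

theorem catalan_le_pureCount (l : ℕ) : (catalan l : ℝ≥0∞) ≤ pureCount l := by
  induction l using Nat.strong_induction_on with
  | _ l ih =>
    cases l with
    | zero =>
      rw [catalan_zero, pureCount]
      refine le_trans ?_ (ENNReal.le_tsum (⟨[], hasTail_zero_iff.2 (by simp)⟩ : pureSet 0))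
      simp
    | succ l =>
      refine le_trans ?_ (pureCount_succ_ge l)
      rw [catalan_succ']
      push_cast
      refine Finset.sum_le_sum fun x hx => ?_
      have := HasAntidiagonal.mem_antidiagonal.1 hx
      gcongr <;> apply ih <;> omega

section recursion
variable (C k l : ℕ)

/-- The four kinds of elements of `tailSet (k + 1) l` that are counted. -/
abbrev Kind := (Unit ⊕ Unit) ⊕ (Fin l ⊕ Fin l × Fin (C + 1))

/-- In order: absorb a tail value into an empty body (which yields one cut, hence `k = 0`), absorb
into a nonempty body, insert into an object with empty body, insert into one with nonempty body. In
the last, `d` is the number of cuts of the right object kept beyond the chosen one; the bound `C`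
only truncates the sum. -/
def Arg : Kind C l → Type
  | .inl (.inl _) => {_π : pureSet (l + 1) // k = 0}
  | .inl (.inr _) => tailSet k (l + 1)
  | .inr (.inl i) => pureSet (i + 1) × tailSet k (l - 1 - i)
  | .inr (.inr (i, d)) => tailSet (k - d) (i + 1) × tailSet d (l - 1 - i)

theorem exists_cut {b q d : ℕ} {w : List ℕ} (h : (b, w) ∈ tailSet d q) :
    ∃ j, (j = 0 ∨ j ∈ cuts b w) ∧ ((cuts b w).filter (j < ·)).card = d :=
  exists_card_filter_lt (fun _ hx => (mem_cutSet.1 hx).1.1) h.2.2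

theorem insertable_pure {p q k b : ℕ} {v w : List ℕ} (hv : v ∈ pureSet (p + 1))
    (hw : (b, w) ∈ tailSet k q) : Insertable 0 b (p + 1) q 0 v w :=
  ⟨hv, hw.2.1, by omega, hw.1, by omega, fun _ => rfl, Or.inl rfl⟩

theorem insertable_cut {p q c d a b j : ℕ} {v w : List ℕ} (hv : (a, v) ∈ tailSet c (p + 1))
    (hw : (b, w) ∈ tailSet d q) (hj : j = 0 ∨ j ∈ cuts b w) :
    Insertable a b (p + 1) q j v w :=
  ⟨hv.2.1, hw.2.1, by omega, hw.1, by
    rcases hj with rfl | hj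
    · omega
    · exact (mem_cutSet.1 hj).1.2, fun h => by have := hv.1; simp only at this; omega, hj⟩

/-- The pair encoded by an argument. -/
noncomputable def build : ∀ i, Arg C k l i → ℕ × List ℕ
  | .inl (.inl _), x => (1, x.1.1)
  | .inl (.inr _), x => (x.1.1 + 1, x.1.2)
  | .inr (.inl i), x => (x.2.1.1 + 1, insertAt 0 x.2.1.1 0 (l - 1 - i) x.1.1 x.2.1.2)
  | .inr (.inr (i, _)), x => (x.1.1.1 + x.2.1.1 + 1,
      insertAt x.1.1.1 x.2.1.1 (exists_cut x.2.2).choose (l - 1 - i) x.1.1.2 x.2.1.2)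

theorem build_mem : ∀ i (x : Arg C k l i), build C k l i x ∈ tailSet (k + 1) l
  | .inl (.inl _), ⟨⟨π, h⟩, hk⟩ => by
    obtain ⟨h1, h2, -⟩ := HasTail.append_shift h
    rw [zero_add] at h1 h2
    exact ⟨le_rfl, h1, by simp only [build] at *; omega⟩
  | .inl (.inr _), ⟨⟨m, π⟩, h⟩ => by
    obtain ⟨h1, h2, -⟩ := HasTail.append_shift h.2.1
    have := h.2.2
    exact ⟨by simp [build], h1, by simp only [build] at *; omega⟩
  | .inr (.inl i), ⟨⟨v, hv⟩, ⟨⟨b, w⟩, hw⟩⟩ => by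
    obtain ⟨h1, h2⟩ := (insertable_pure hv hw).hasTail
    have h3 : (cuts b w).filter (0 < ·) = cuts b w :=
      filter_true_of_mem fun x hx => (mem_cutSet.1 hx).1.1
    have h4 := hw.2.2
    rw [h3] at h2
    rw [show i.1 + 1 + (l - 1 - i) = l by omega] at h1
    rw [zero_add] at h1 h2
    exact ⟨by simp [build], h1, by simp only [build] at *; omega⟩
  | .inr (.inr (i, d)), ⟨⟨⟨a, v⟩, hv⟩, ⟨⟨b, w⟩, hw⟩⟩ => by
    have hj := (exists_cut hw).choose_spec
    obtain ⟨h1, h2⟩ := (insertable_cut hv hw hj.1).hasTail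
    have h4 := hv.2.2
    rw [hj.2] at h2
    rw [show i.1 + 1 + (l - 1 - i) = l by omega] at h1
    exact ⟨by simp [build], h1, by simp only [build] at *; omega⟩

/-- Absorption and insertion are told apart by the position of the body maximum. Within insertions
all data are recovered by `Insertable.inj`; `a = 0` or not separates the two kinds, `p` gives `i`,
and `d` is the number of cuts of `w` beyond `j`. -/
theorem build_injective :
    Function.Injective fun z : Σ i, Arg C k l i => build C k l z.1 z.2 := by
  have shape : ∀ z : Σ i, Arg C k l i,
      (∃ m π, build C k l z.1 z.2 = (m + 1, π) ∧ (stackSort π)[m]? = some (m + 1) ∧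
        ((∃ (h : π ∈ pureSet (l + 1)) (hk : k = 0), m = 0 ∧ z = ⟨.inl (.inl ()), ⟨π, h⟩, hk⟩) ∨
          ∃ h, 1 ≤ m ∧ z = ⟨.inl (.inr ()), ⟨(m, π), h⟩⟩)) ∨
      (∃ a b p q j v w, build C k l z.1 z.2 = (a + b + 1, insertAt a b j q v w) ∧
        Insertable a b p q j v w ∧ p + q = l ∧
        ((∃ (i : Fin l) (h : v ∈ pureSet (i + 1)) (h' : (b, w) ∈ tailSet k (l - 1 - i)),
            a = 0 ∧ p = i + 1 ∧ z = ⟨.inr (.inl i), ⟨v, h⟩, ⟨(b, w), h'⟩⟩) ∨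
          ∃ (i : Fin l) (d : Fin (C + 1)) (h : (a, v) ∈ tailSet (k - d) (i + 1))
            (h' : (b, w) ∈ tailSet d (l - 1 - i)), 1 ≤ a ∧ p = i + 1 ∧
            ((cuts b w).filter (j < ·)).card = d ∧
            z = ⟨.inr (.inr (i, d)), ⟨(a, v), h⟩, ⟨(b, w), h'⟩⟩)) := by
    rintro ⟨(⟨⟩ | ⟨⟩) | i | ⟨i, d⟩, x⟩
    · obtain ⟨⟨π, h⟩, hk⟩ := x
      exact Or.inl ⟨0, π, rfl, (HasTail.append_shift h).2.2, Or.inl ⟨h, hk, rfl, rfl⟩⟩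
    · obtain ⟨⟨m, π⟩, h⟩ := x
      exact Or.inl ⟨m, π, rfl, (HasTail.append_shift h.2.1).2.2, Or.inr ⟨h, h.1, rfl⟩⟩
    · obtain ⟨⟨v, hv⟩, ⟨⟨b, w⟩, hw⟩⟩ := x
      exact Or.inr ⟨0, b, i + 1, _, 0, v, w, by simp [build], insertable_pure hv hw, by omega,
        Or.inl ⟨i, hv, hw, rfl, rfl, rfl⟩⟩
    · obtain ⟨⟨⟨a, v⟩, hv⟩, ⟨⟨b, w⟩, hw⟩⟩ := x
      have hj := (exists_cut hw).choose_spec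
      exact Or.inr ⟨a, b, i + 1, _, _, v, w, rfl, insertable_cut hv hw hj.1, by omega,
        Or.inr ⟨i, d, hv, hw, hv.1, rfl, hj.2, rfl⟩⟩
  intro z z' he
  simp only at he
  rcases shape z with ⟨m, π, hb, hs, hz⟩ | ⟨a, b, p, q, j, v, w, hb, hi, hl, hz⟩ <;>
  rcases shape z' with ⟨m', π', hb', hs', hz'⟩ | ⟨a', b', p', q', j', v', w', hb', hi', hl', hz'⟩
  · rw [hb, hb', Prod.mk.injEq, add_left_inj] at he
    obtain ⟨rfl, rfl⟩ := he
    rcases hz with ⟨h, hk, h0, rfl⟩ | ⟨h, h0, rfl⟩ <;>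
    rcases hz' with ⟨h', hk', h0', rfl⟩ | ⟨h', h0', rfl⟩
    · rfl
    · omega
    · omega
    · rfl
  · rw [hb, hb', Prod.mk.injEq, add_left_inj] at he
    rw [he.1, he.2] at hs
    exact absurd hs hi'.getElem_ne
  · rw [hb, hb', Prod.mk.injEq, add_left_inj] at he
    rw [← he.1, ← he.2] at hs'
    exact absurd hs' hi.getElem_ne
  · rw [hb, hb', Prod.mk.injEq, add_left_inj] at he
    obtain ⟨rfl, rfl, rfl, rfl, rfl, rfl, rfl⟩ := hi.inj hi' he.1 (hl.trans hl'.symm) he.2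
    rcases hz with ⟨i, h1, h2, h0, hp, rfl⟩ | ⟨i, d, h1, h2, h0, hp, hc, rfl⟩ <;>
    rcases hz' with ⟨i', h1', h2', h0', hp', rfl⟩ | ⟨i', d', h1', h2', h0', hp', hc', rfl⟩
    · obtain rfl : i = i' := by ext; omega
      rfl
    · omega
    · omega
    · obtain rfl : i = i' := by ext; omega
      obtain rfl : d = d' := by ext; omega
      rfl

theorem tailSum_succ_ge (y : ℝ≥0∞) :
    y * ((if k = 0 then pureCount (l + 1) else 0) + tailSum y k (l + 1) +
      ∑ i ∈ range l, (pureCount (i + 1) * tailSum y k (l - 1 - i) +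
        ∑ d ∈ range (C + 1), tailSum y (k - d) (i + 1) * tailSum y d (l - 1 - i))) ≤
    tailSum y (k + 1) l := by
  refine le_trans (le_of_eq ?_) (sum_tsum_le_of_injective (T := tailSet (k + 1) l)
    (fun i x => ⟨build C k l i x, build_mem C k l i x⟩) (fun a b h => build_injective C k l
      (by simpa using h)) fun x => y ^ x.1.1)
  simp only [Fintype.sum_sum_type, Fintype.sum_prod_type, Finset.sum_range, univ_unique,
    sum_singleton, mul_add, Finset.mul_sum, Finset.sum_add_distrib]
  congr 1
  · congr 1
    · unfold pureCount
      split_ifs with hk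
      · rw [← ENNReal.tsum_mul_left, ← (Equiv.subtypeUnivEquiv fun _ => hk).tsum_eq]
        exact tsum_congr fun x => by simp [build]
      · have : IsEmpty (Arg C k l (.inl (.inl ()))) := ⟨fun x => hk x.2⟩
        rw [mul_zero, tsum_empty]
    · unfold tailSum
      rw [← ENNReal.tsum_mul_left]
      exact tsum_congr fun x => by simp [build, pow_succ, mul_comm]
  · congr 1
    · refine Finset.sum_congr rfl fun i _ => ?_
      unfold tailSum pureCount
      rw [← tsum_prod_mul, ← ENNReal.tsum_mul_left]
      exact tsum_congr fun x => by simp [build, pow_succ, mul_comm]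
    · refine Finset.sum_congr rfl fun i _ => Finset.sum_congr rfl fun d _ => ?_
      unfold tailSum
      rw [← tsum_prod_mul, ← ENNReal.tsum_mul_left]
      exact tsum_congr fun x => by simp [build, pow_succ, pow_add, mul_comm]
end recursion

/-- The full length `m ≥ 1` is always a cut. -/
theorem tailSum_zero (y : ℝ≥0∞) (l : ℕ) : tailSum y 0 l = tailSum y 1 l := by
  have : tailSet 0 l = tailSet 1 l := by
    ext ⟨m, π⟩
    refine ⟨fun h => ⟨h.1, h.2.1, card_pos.2 ⟨m, ?_⟩⟩, fun h => ⟨h.1, h.2.1, Nat.zero_le _⟩⟩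
    obtain ⟨τ, h1, h2⟩ := h.2.1
    simp only at h1 h2
    rw [cuts, mem_cutSet, take_of_eq h1 h2]
    refine ⟨⟨h.1, le_rfl⟩, fun x hx => ?_⟩
    have := List.mem_of_mem_take hx
    rw [(stackSort_perm _).mem_iff, (perm_of_stackSort_stackSort h2).mem_iff] at this
    simp at this; omega
  rw [tailSum, tailSum, this]

theorem tailSum_one_zero_le (y : ℝ≥0∞) :
    tailSum y 1 0 ≤ ∑' n : ℕ, (W 3 (n + 1) : ℝ≥0∞) * y ^ (n + 1) := by
  have hmem : ∀ x : tailSet 1 0, x.1.2 ∈ (permsOf (x.1.1 - 1 + 1)).filter (IsStackSortable 3) := by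
    rintro ⟨⟨m, π⟩, h⟩
    have hm := h.1
    have hp := h.2.1.perm
    obtain ⟨τ, h1, h2⟩ := h.2.1
    simp only at hm hp h1 h2 ⊢
    rw [Nat.sub_add_cancel hm, mem_filter]
    refine ⟨by simpa [permsOf] using hp, ?_⟩
    have : stackSort π = τ := by simpa using h1
    simp only [IsStackSortable, Function.iterate_succ, Function.iterate_zero, Function.comp, id, this,
      h2]
    exact List.pairwise_lt_range' 
  have hinj : Function.Injective (fun x : tailSet 1 0 => (⟨x.1.1 - 1, x.1.2, hmem x⟩ :
      Σ n, {π // π ∈ (permsOf (n + 1)).filter (IsStackSortable 3)})) := by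
    rintro ⟨⟨m, π⟩, h⟩ ⟨⟨m', π'⟩, h'⟩ he
    have e1 := congrArg Sigma.fst he
    have e2 : π = π' := congrArg (fun z : Σ n, {π // π ∈ (permsOf (n + 1)).filter
      (IsStackSortable 3)} => z.2.1) he
    have := h.1
    have := h'.1
    simp only at *
    obtain rfl : m = m' := by omega
    subst e2
    rfl
  calc tailSum y 1 0 = ∑' x : tailSet 1 0, y ^ (x.1.1 - 1 + 1) := by
        refine tsum_congr fun x => ?_
        rw [Nat.sub_add_cancel x.2.1]
    _ ≤ ∑' z : Σ n, {π // π ∈ (permsOf (n + 1)).filter (IsStackSortable 3)}, y ^ (z.1 + 1) :=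
        ENNReal.tsum_comp_le_tsum_of_injective hinj fun z => y ^ (z.1 + 1)
    _ = _ := by
        rw [ENNReal.tsum_sigma']
        refine tsum_congr fun n => ?_
        simp [W, tsum_fintype]

/-! ### Tables packed into integers -/

open scoped ENNReal Polynomial

/-- The number with digits `f c n` (`c < m`, `n < R`), in base `2 ^ b`, at position `c * R + n`. -/
def packed (b R m : ℕ) (f : ℕ → ℕ → ℕ) : ℕ :=
  ∑ c ∈ range m, ∑ n ∈ range R, f c n * ((2 ^ b) ^ n * ((2 ^ b) ^ R) ^ c)

theorem sum_range_mul' {M : Type*} [AddCommMonoid M] (f : ℕ → M) (m R : ℕ) :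
    ∑ i ∈ range (m * R), f i = ∑ c ∈ range m, ∑ n ∈ range R, f (c * R + n) := by
  induction m with
  | zero => simp
  | succ m ih => rw [Nat.succ_mul, sum_range_add, ih, sum_range_succ]

theorem packed_eq_sum {b R m : ℕ} {f : ℕ → ℕ → ℕ} (hR : 0 < R) :
    packed b R m f = ∑ i ∈ range (m * R), f (i / R) (i % R) * (2 ^ b) ^ i := by
  rw [sum_range_mul', packed]
  refine sum_congr rfl fun c _ => sum_congr rfl fun n hn => ?_
  have hn := mem_range.1 hn
  rw [show (c * R + n) / R = c by
    rw [mul_comm, Nat.mul_add_div hR, Nat.div_eq_of_lt hn, add_zero],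
    show (c * R + n) % R = n by rw [mul_comm, Nat.mul_add_mod, Nat.mod_eq_of_lt hn]]
  rw [show (2 ^ b) ^ (c * R + n) = (2 ^ b) ^ n * ((2 ^ b) ^ R) ^ c by
    rw [← pow_mul (2 ^ b) R c, ← pow_add]; congr 1; ring]

theorem sum_digits_lt {b : ℕ} {a : ℕ → ℕ} (ha : ∀ i, a i < 2 ^ b) (N : ℕ) :
    ∑ i ∈ range N, a i * (2 ^ b) ^ i < 2 ^ (b * N) := by
  induction N with
  | zero => simp
  | succ N ih =>
    rw [sum_range_succ, ← pow_mul]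
    have h1 : a N * 2 ^ (b * N) + 2 ^ (b * N) ≤ 2 ^ b * 2 ^ (b * N) := by
      rw [← Nat.succ_mul]; exact Nat.mul_le_mul_right _ (ha N)
    rw [mul_add, mul_one, pow_add, mul_comm (2 ^ (b * N))]
    omega

theorem testBit_sum_digits {b : ℕ} (hb : 0 < b) {a : ℕ → ℕ} (ha : ∀ i, a i < 2 ^ b) (N t : ℕ) :
    (∑ i ∈ range N, a i * (2 ^ b) ^ i).testBit t =
      (decide (t / b < N) && (a (t / b)).testBit (t % b)) := by
  induction N with
  | zero => simp
  | succ N ih =>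
    rw [sum_range_succ, ← pow_mul, add_comm, mul_comm (a N),
      Nat.testBit_two_pow_mul_add _ (sum_digits_lt ha N), ih]
    have hdm := Nat.div_add_mod t b
    have hlt := Nat.mod_lt t hb
    split_ifs with h
    · have : t / b < N := by rw [Nat.div_lt_iff_lt_mul hb, mul_comm]; exact h
      simp [this, this.trans N.lt_succ_self]
    · have h1 : ¬ t / b < N := by rw [Nat.div_lt_iff_lt_mul hb, mul_comm]; exact h
      rcases eq_or_ne (t / b) N with h2 | h2
      · rw [h2] at hdm
        rw [show t - b * N = t % b by omega, h2]
        simp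
      · have h3 : N + 1 ≤ t / b := by omega
        have h4 : b * (N + 1) ≤ t := by
          have := Nat.mul_le_mul_left b h3; omega
        rw [mul_add, mul_one] at h4
        have : (a N).testBit (t - b * N) = false :=
          Nat.testBit_lt_two_pow ((ha N).trans_le (Nat.pow_le_pow_right (by norm_num) (by omega)))
        simp [this]; omega

/-- Shifting and masking act digit by digit. -/
theorem packed_extract {b R m m' L lo D s c₀ n₀ : ℕ} {f : ℕ → ℕ → ℕ}
    (hf : ∀ c n, f c n < 2 ^ b) (hfm : ∀ c n, m ≤ c → f c n = 0) (hD : 0 < D) (hs : D + s ≤ b)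
    (hR : L + n₀ < R) :
    (packed b R m f >>> (s + (c₀ * R + n₀) * b)) &&&
      packed b R m' (fun _ n => if lo ≤ n ∧ n ≤ L then 2 ^ D - 1 else 0) =
    packed b R m' fun c n => if lo ≤ n ∧ n ≤ L then (f (c + c₀) (n + n₀) >>> s) % 2 ^ D else 0 := by
  have hR0 : 0 < R := by omega
  have hb : 0 < b := by omega
  have hDb : 2 ^ D ≤ 2 ^ b := Nat.pow_le_pow_right (by norm_num) (by omega)
  have hDp : 0 < 2 ^ D := by positivity
  rw [packed_eq_sum hR0, packed_eq_sum hR0, packed_eq_sum hR0]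
  refine Nat.eq_of_testBit_eq fun t => ?_
  rw [Nat.testBit_and, Nat.testBit_shiftRight, testBit_sum_digits hb (fun i => hf _ _),
    testBit_sum_digits hb (fun i => by split_ifs <;> omega),
    testBit_sum_digits hb (fun i => by
      split_ifs
      · exact (Nat.mod_lt _ hDp).trans_le hDb
      · omega)]
  have hdm := Nat.div_add_mod t b
  have hlt := Nat.mod_lt t hb
  set i := t / b with hi
  set r := t % b with hr
  have hidm := Nat.div_add_mod i R
  have hilt := Nat.mod_lt i hR0
  by_cases h1 : i < m' * R
  swap
  · simp [h1]
  by_cases h2 : lo ≤ i % R ∧ i % R ≤ L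
  swap
  · simp [h2]
  by_cases h3 : r < D
  swap
  · simp [h2, Nat.testBit_two_pow_sub_one, Nat.testBit_mod_two_pow, h3]
  have e1 : s + (c₀ * R + n₀) * b + t = b * (i + (c₀ * R + n₀)) + (r + s) := by
    rw [← hdm]; ring
  have e2 : (s + (c₀ * R + n₀) * b + t) / b = i + (c₀ * R + n₀) := by
    rw [e1, Nat.mul_add_div hb, Nat.div_eq_of_lt (by omega), add_zero]
  have e3 : (s + (c₀ * R + n₀) * b + t) % b = r + s := by
    rw [e1, Nat.mul_add_mod, Nat.mod_eq_of_lt (by omega)]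
  have e4 : i + (c₀ * R + n₀) = R * (i / R + c₀) + (i % R + n₀) := by
    conv_lhs => rw [← hidm]
    ring
  have e5 : (i + (c₀ * R + n₀)) / R = i / R + c₀ := by
    rw [e4, Nat.mul_add_div hR0, Nat.div_eq_of_lt (by omega : i % R + n₀ < R), add_zero]
  have e6 : (i + (c₀ * R + n₀)) % R = i % R + n₀ := by
    rw [e4, Nat.mul_add_mod, Nat.mod_eq_of_lt (by omega : i % R + n₀ < R)]
  rw [e2, e3, e5, e6]
  simp only [h1, h2, and_self, if_true, Nat.testBit_two_pow_sub_one, Nat.testBit_mod_two_pow, h3,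
    decide_true, Bool.true_and, Bool.and_true, Nat.testBit_shiftRight, add_comm s r]
  by_cases h4 : i + (c₀ * R + n₀) < m * R
  · simp [h4]
  · have : m ≤ i / R + c₀ := by
      rw [← e5, Nat.le_div_iff_mul_le hR0]; omega
    simp [hfm _ _ this]

theorem packed_add (b R m : ℕ) (f g : ℕ → ℕ → ℕ) :
    packed b R m f + packed b R m g = packed b R m fun c n => f c n + g c n := by
  simp only [packed, ← sum_add_distrib, add_mul]

theorem packed_mul_left (b R m k : ℕ) (f : ℕ → ℕ → ℕ) :
    k * packed b R m f = packed b R m fun c n => k * f c n := by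
  simp only [packed, Finset.mul_sum, mul_assoc]

theorem packed_congr {b R m : ℕ} {f g : ℕ → ℕ → ℕ} (h : ∀ c < m, ∀ n < R, f c n = g c n) :
    packed b R m f = packed b R m g :=
  sum_congr rfl fun c hc => sum_congr rfl fun n hn => by
    rw [h c (mem_range.1 hc) n (mem_range.1 hn)]

theorem packed_extend {b R m : ℕ} {f : ℕ → ℕ → ℕ} (h : ∀ c n, m ≤ c → f c n = 0) {m' : ℕ}
    (hm : m ≤ m') : packed b R m f = packed b R m' f := by
  refine sum_subset (range_subset_range.2 hm) fun c _ hc => ?_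
  exact sum_eq_zero fun n _ => by rw [h c n (by simpa using hc), zero_mul]

theorem packed_shift_row (b R m k : ℕ) (f : ℕ → ℕ → ℕ) :
    packed b R m f * ((2 ^ b) ^ R) ^ k =
      packed b R (k + m) fun c n => if k ≤ c then f (c - k) n else 0 := by
  symm
  rw [packed, packed, sum_range_add, sum_eq_zero, zero_add, sum_mul]
  · refine sum_congr rfl fun c _ => ?_
    rw [sum_mul]
    refine sum_congr rfl fun n _ => ?_
    rw [if_pos (by omega), Nat.add_sub_cancel_left, pow_add]
    ring
  · intro c hc
    have := mem_range.1 hc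
    exact sum_eq_zero fun n _ => by rw [if_neg (by omega), zero_mul]

theorem packed_shift_col {b R m : ℕ} {f : ℕ → ℕ → ℕ} (hf : ∀ c, f c (R - 1) = 0) (hR : 0 < R) :
    packed b R m f * 2 ^ b = packed b R m fun c n => if n = 0 then 0 else f c (n - 1) := by
  rw [packed, packed, sum_mul]
  refine sum_congr rfl fun c _ => ?_
  obtain ⟨r, rfl⟩ : ∃ r, R = r + 1 := ⟨R - 1, by omega⟩
  have h0 : f c r = 0 := hf c
  rw [sum_range_succ, sum_range_succ', h0, if_pos rfl, zero_mul, zero_mul, add_zero, add_zero,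
    sum_mul]
  refine sum_congr rfl fun n _ => ?_
  rw [if_neg (Nat.succ_ne_zero n), Nat.add_sub_cancel, pow_succ]
  ring

/-- The bivariate polynomial with the given digits. -/
noncomputable def packedPoly (R m : ℕ) (f : ℕ → ℕ → ℕ) : ℕ[X][X] :=
  ∑ c ∈ range m, Polynomial.monomial c (∑ n ∈ range R, Polynomial.monomial n (f c n))

theorem coeff_packedPoly (R m : ℕ) (f : ℕ → ℕ → ℕ) (c n : ℕ) :
    ((packedPoly R m f).coeff c).coeff n = if c < m ∧ n < R then f c n else 0 := by
  simp only [packedPoly, Polynomial.finsetSum_coeff, Polynomial.coeff_monomial]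
  rw [← Polynomial.finsetSum_coeff, sum_ite_eq']
  split_ifs with h1 h2 h2
  · simp only [Polynomial.finsetSum_coeff, Polynomial.coeff_monomial]
    rw [sum_ite_eq', if_pos (by simpa using h2.2)]
  · simp only [Polynomial.finsetSum_coeff, Polynomial.coeff_monomial]
    rw [sum_ite_eq', if_neg (by simp at h1 h2 ⊢; omega)]
  · simp at h1; omega
  · simp

theorem evalEval_packedPoly (b R m : ℕ) (f : ℕ → ℕ → ℕ) :
    (packedPoly R m f).evalEval (2 ^ b) ((2 ^ b) ^ R) = packed b R m f := by
  simp only [packedPoly, packed, Polynomial.evalEval, Polynomial.eval_finsetSum,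
    Polynomial.eval_monomial, Polynomial.eval_mul, Polynomial.eval_pow, Polynomial.eval_C, sum_mul,
    mul_assoc]

theorem evalEval_eq_packed {b R m : ℕ} {P : ℕ[X][X]} (hm : ∀ c, m ≤ c → P.coeff c = 0)
    (hR : ∀ c n, R ≤ n → (P.coeff c).coeff n = 0) :
    P.evalEval (2 ^ b) ((2 ^ b) ^ R) = packed b R m fun c n => (P.coeff c).coeff n := by
  rw [← evalEval_packedPoly]
  congr 1
  ext c n
  rw [coeff_packedPoly]
  split_ifs with h
  · rfl
  · by_cases hc : m ≤ c
    · simp [hm c hc]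
    · exact hR c n (by omega)

def convolve (f g : ℕ → ℕ → ℕ) (e n : ℕ) : ℕ :=
  ∑ d ∈ range (e + 1), ∑ p ∈ range (n + 1), f (e - d) p * g d (n - p)

/-- Kronecker substitution: a packed table is the value of a bivariate polynomial at `(2 ^ b, (2 ^
b) ^ R)`. The condition `2 * L < R` keeps product columns inside their row. Digit sizes play no role
here; they matter only when digits are read back. -/
theorem packed_mul {b R m m' L : ℕ} {f g : ℕ → ℕ → ℕ} (hL : 2 * L < R)
    (hf : ∀ c n, m ≤ c → f c n = 0) (hf' : ∀ c n, L < n → f c n = 0)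
    (hg : ∀ c n, m' ≤ c → g c n = 0) (hg' : ∀ c n, L < n → g c n = 0) :
    packed b R m f * packed b R m' g = packed b R (m + m') (convolve f g) := by
  have cf : ∀ c n, ((packedPoly R m f).coeff c).coeff n = f c n := fun c n => by
    rw [coeff_packedPoly]
    split_ifs with h
    · rfl
    · by_cases hc : m ≤ c
      · rw [hf c n hc]
      · rw [hf' c n (by omega)]
  have cg : ∀ c n, ((packedPoly R m' g).coeff c).coeff n = g c n := fun c n => by
    rw [coeff_packedPoly]
    split_ifs with h
    · rfl
    · by_cases hc : m' ≤ c
      · rw [hg c n hc]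
      · rw [hg' c n (by omega)]
  have key : ∀ e n, ((packedPoly R m f * packedPoly R m' g).coeff e).coeff n =
      convolve f g e n := by
    intro e n
    rw [Polynomial.coeff_mul, Polynomial.finsetSum_coeff, ← Finset.Nat.sum_antidiagonal_swap,
      Finset.Nat.sum_antidiagonal_eq_sum_range_succ_mk]
    refine sum_congr rfl fun d _ => ?_
    rw [Polynomial.coeff_mul, Finset.Nat.sum_antidiagonal_eq_sum_range_succ_mk]
    exact sum_congr rfl fun p _ => by simp only [cf, cg, Prod.swap]
  rw [← evalEval_packedPoly, ← evalEval_packedPoly, ← Polynomial.evalEval_mul,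
    evalEval_eq_packed (m := m + m')]
  · simp only [key]
  · intro e he
    ext n
    rw [key, convolve, Polynomial.coeff_zero]
    refine sum_eq_zero fun d hd => sum_eq_zero fun p _ => ?_
    by_cases h : m' ≤ d
    · rw [hg d _ h, mul_zero]
    · rw [hf (e - d) _ (by omega), zero_mul]
  · intro e n hn
    rw [key, convolve]
    refine sum_eq_zero fun d hd => sum_eq_zero fun p hp => ?_
    by_cases h : L < p
    · rw [hf' _ p h, zero_mul]
    · rw [hg' _ (n - p) (by omega), mul_zero]

/-- `∑ i < n, 2 ^ (w * i)` -/
def ones (w : ℕ) : ℕ → ℕ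
  | 0 => 0
  | n + 1 => ones w n <<< w + 1

theorem ones_eq (w n : ℕ) : ones w n = ∑ i ∈ range n, (2 ^ w) ^ i := by
  induction n with
  | zero => rfl
  | succ n ih =>
    rw [ones, ih, Nat.shiftLeft_eq, sum_range_succ', sum_mul]
    simp [pow_succ]

def mask (b R m lo L D : ℕ) : ℕ :=
  ((ones b (L + 1 - lo) * (2 ^ D - 1)) <<< (lo * b)) * ones (R * b) m

theorem packed_row {b R N : ℕ} (hN : N ≤ R) (h : ℕ → ℕ) :
    packed b R 1 (fun c n => if c = 0 ∧ n < N then h n else 0) =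
      ∑ n ∈ range N, h n * (2 ^ b) ^ n := by
  rw [packed, sum_range_one, ← sum_subset (range_subset_range.2 hN)]
  · exact sum_congr rfl fun n hn => by simp [mem_range.1 hn]
  · intro n _ hn
    simp at hn
    simp [hn]

theorem packed_one_mul_ones (b R m : ℕ) (f : ℕ → ℕ → ℕ) :
    packed b R 1 f * ones (R * b) m = packed b R m fun _ n => f 0 n := by
  rw [ones_eq, packed, packed, sum_range_one, mul_sum]
  refine sum_congr rfl fun c _ => ?_
  rw [sum_mul]
  exact sum_congr rfl fun n _ => by rw [pow_zero, mul_one, mul_comm R b, pow_mul, mul_assoc]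

theorem mask_eq {b R m lo L D : ℕ} (hL : L < R) (hlo : lo ≤ L) :
    mask b R m lo L D =
      packed b R m fun _ n => if lo ≤ n ∧ n ≤ L then 2 ^ D - 1 else 0 := by
  have h1 : (ones b (L + 1 - lo) * (2 ^ D - 1)) <<< (lo * b) =
      packed b R 1 (fun c n => if c = 0 ∧ n < L + 1 then (if lo ≤ n then 2 ^ D - 1 else 0) else 0) := by
    obtain ⟨k, hk⟩ : ∃ k, L + 1 = lo + k := ⟨L + 1 - lo, by omega⟩
    rw [packed_row (by omega), hk, sum_range_add, sum_eq_zero, zero_add, Nat.add_sub_cancel_left,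
      Nat.shiftLeft_eq, ones_eq, mul_comm lo, pow_mul, sum_mul, sum_mul]
    · refine sum_congr rfl fun i _ => ?_
      rw [if_pos (by omega), pow_add]; ring
    · intro i hi
      rw [if_neg (by have := mem_range.1 hi; omega), zero_mul]
  rw [mask, h1, packed_one_mul_ones]
  refine packed_congr fun c _ n _ => ?_
  by_cases h : lo ≤ n <;> by_cases h' : n ≤ L <;> simp [h, h']

/-- `∑ t < n, ⌊C_{i + t} 2 ^ e / 8 ^ (i + t)⌋ 2 ^ (b * t)`, where `c = C_i` is a Catalan number. -/
def catalanRow (b e : ℕ) : ℕ → ℕ → ℕ → ℕ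
  | 0, _, _ => 0
  | n + 1, i, c =>
    c * 2 ^ e / 8 ^ i + catalanRow b e n (i + 1) (c * (4 * i + 2) / (i + 2)) <<< b

theorem catalan_succ_eq (i : ℕ) : catalan i * (4 * i + 2) / (i + 2) = catalan (i + 1) := by
  apply Nat.div_eq_of_eq_mul_left (by omega)
  have h1 := succ_mul_catalan_eq_centralBinom i
  have h2 := succ_mul_catalan_eq_centralBinom (i + 1)
  have h3 := Nat.succ_mul_centralBinom_succ i
  rw [← h1, ← h2] at h3
  have : (i + 1) * (catalan i * (4 * i + 2)) = (i + 1) * (catalan (i + 1) * (i + 2)) := by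
    linarith
  exact Nat.eq_of_mul_eq_mul_left (by omega) this

theorem catalanRow_eq (b e n i : ℕ) : catalanRow b e n i (catalan i) =
    ∑ t ∈ range n, catalan (i + t) * 2 ^ e / 8 ^ (i + t) * (2 ^ b) ^ t := by
  induction n generalizing i with
  | zero => rfl
  | succ n ih =>
    rw [catalanRow, catalan_succ_eq, ih, sum_range_succ', Nat.shiftLeft_eq, sum_mul, add_comm]
    simp only [pow_zero, mul_one, add_zero]
    congr 1
    refine sum_congr rfl fun t _ => ?_
    rw [pow_succ, show i + 1 + t = i + (t + 1) by omega, mul_assoc]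

theorem catalanRow_one (b e n : ℕ) : catalanRow b e n 1 1 =
    ∑ t ∈ range n, catalan (1 + t) * 2 ^ e / 8 ^ (1 + t) * (2 ^ b) ^ t := by
  have := catalanRow_eq b e n 1
  rwa [catalan_one] at this

/-! ### One step of the iteration on packed tables -/

/-- Table row `c` stands for at least `c + 1` cuts. Here row `c` stands for at least `c` cuts, row 0
being duplicated in accordance with `tailSum_zero`. -/
def rowsG (b R Mr x : ℕ) : ℕ := x <<< (R * b) + (x &&& Mr)

/-- The left factor, offset by `C` rows: row `C + k` stands for `k` cuts, and the rows below repeat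
the case of no cuts, so that `k - d` truncated at 0 is covered by a plain convolution. Column 0 is
removed since the left tail is nonempty, and `K1` puts the Catalan numbers into row `C`. -/
def rowsA (b R C M1 Mr1 O K1 x : ℕ) : ℕ :=
  (x &&& M1) <<< ((C + 1) * R * b) + ((x &&& Mr1) * O + K1)

/-- One step of the iteration on packed integers. -/
def packedStep (b R C M M1 Mr Mr1 O K1 K2 x : ℕ) : ℕ :=
  (6911 * (rowsG b R Mr x <<< (C * R * b + 33) +
    ((rowsA b R C M1 Mr1 O K1 x * rowsG b R Mr x) <<< b + K2))) >>> (46 + (C * R + 1) * b) &&& M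

section step
variable {b R C L D : ℕ} {x : ℕ → ℕ → ℕ}

/-- The digits of `rowsA`. -/
def digitA (C L : ℕ) (x : ℕ → ℕ → ℕ) (e p : ℕ) : ℕ :=
  (if 1 ≤ p then x (e - C - 1) p else 0) +
    if e = C ∧ 1 ≤ p ∧ p ≤ L then catalan p * 2 ^ 30 / 8 ^ p else 0

structure IsTable (C L D : ℕ) (x : ℕ → ℕ → ℕ) : Prop where
  lt : ∀ c n, x c n < 2 ^ D
  row : ∀ c n, C ≤ c → x c n = 0
  col : ∀ c n, L < n → x c n = 0

theorem IsTable.and_mask (hx : IsTable C L D x) (hL : L < R) (hD : 0 < D) (hDb : D ≤ b)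
    (m lo : ℕ) (hlo : lo ≤ L) :
    packed b R C x &&& mask b R m lo L D = packed b R m fun c n => if lo ≤ n then x c n else 0 := by
  rw [mask_eq hL hlo]
  have := packed_extract (b := b) (R := R) (m := C) (m' := m) (L := L) (lo := lo) (D := D)
    (s := 0) (c₀ := 0) (n₀ := 0) (f := x)
    (fun c n => (hx.lt c n).trans_le (Nat.pow_le_pow_right (by norm_num) hDb)) hx.row hD
    (by omega) (by omega)
  simp only [zero_mul, add_zero, Nat.shiftRight_zero] at this
  rw [this]
  refine packed_congr fun c _ n _ => ?_
  rw [Nat.mod_eq_of_lt (hx.lt c n)]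
  by_cases h : lo ≤ n <;> by_cases h' : n ≤ L <;> simp [h, h']
  rw [hx.col c n (by omega)]

theorem packed_split (b R k m : ℕ) (f : ℕ → ℕ → ℕ) :
    packed b R (k + m) f =
      packed b R m (fun c n => f (k + c) n) * ((2 ^ b) ^ R) ^ k + packed b R k f := by
  rw [packed, sum_range_add, add_comm]
  congr 1
  rw [packed, sum_mul]
  refine sum_congr rfl fun c _ => ?_
  rw [sum_mul]
  exact sum_congr rfl fun n _ => by rw [pow_add]; ring

theorem IsTable.rowsG_eq (hx : IsTable C L D x) (hL : L < R) (hD : 0 < D) (hDb : D ≤ b) :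
    rowsG b R (mask b R 1 0 L D) (packed b R C x) =
      packed b R (C + 1) fun c n => x (c - 1) n := by
  rw [rowsG, hx.and_mask hL hD hDb 1 0 (Nat.zero_le _), add_comm C, packed_split,
    Nat.shiftLeft_eq, mul_comm R b, pow_mul, pow_one]
  refine congrArg₂ (· + ·) ?_ (packed_congr fun c hc n _ => ?_)
  · simp only [Nat.add_sub_cancel_left]
  · obtain rfl : c = 0 := by omega
    simp

theorem IsTable.rowsA_eq (hx : IsTable C L D x) (hL : L < R) (hL0 : 1 ≤ L) (hD : 0 < D)
    (hDb : D ≤ b) :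
    rowsA b R C (mask b R C 1 L D) (mask b R 1 1 L D) (ones (R * b) (C + 1))
      (catalanRow b 30 L 1 1 <<< ((C * R + 1) * b)) (packed b R C x) =
      packed b R (C + 1 + C) (digitA C L x) := by
  have hK : catalanRow b 30 L 1 1 <<< ((C * R + 1) * b) =
      packed b R (C + 1) fun c n => if c = C ∧ 1 ≤ n ∧ n ≤ L then
        catalan n * 2 ^ 30 / 8 ^ n else 0 := by
    have h1 : catalanRow b 30 L 1 1 * 2 ^ b = packed b R 1 fun c n => if c = 0 ∧ n < L + 1 then
        (if n = 0 then 0 else catalan n * 2 ^ 30 / 8 ^ n) else 0 := by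
      rw [packed_row (by omega), sum_range_succ']
      rw [catalanRow_one, sum_mul, if_pos rfl, zero_mul, add_zero]
      refine sum_congr rfl fun t _ => ?_
      rw [if_neg (Nat.succ_ne_zero t), pow_succ (2 ^ b), add_comm 1 t, mul_assoc]
    rw [Nat.shiftLeft_eq, show 2 ^ ((C * R + 1) * b) = 2 ^ b * ((2 ^ b) ^ R) ^ C by
      rw [← pow_mul, ← pow_mul, ← pow_add]; congr 1; ring, ← mul_assoc, h1, packed_shift_row]
    refine packed_congr fun c hc n _ => ?_
    by_cases h : c = C
    · subst h
      by_cases h' : n = 0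
      · simp [h']
      · simp [h', Nat.one_le_iff_ne_zero]
    · rw [if_neg (by omega), if_neg (by omega)]
  rw [rowsA, hx.and_mask hL hD hDb C 1 hL0, hx.and_mask hL hD hDb 1 1 hL0, hK,
    packed_one_mul_ones, packed_add, packed_split b R (C + 1) C, Nat.shiftLeft_eq,
    show 2 ^ ((C + 1) * R * b) = ((2 ^ b) ^ R) ^ (C + 1) by
      rw [← pow_mul, ← pow_mul]; congr 1; ring]
  congr 1
  · congr 1
    refine packed_congr fun c _ n _ => ?_
    rw [digitA, if_neg (c := C + 1 + c = C ∧ _) (by omega), add_zero,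
      show C + 1 + c - C - 1 = c by omega]
  · refine packed_congr fun c hc n _ => ?_
    rw [digitA, show c - C - 1 = 0 by omega]

/-- The digits before rescaling. -/
def digitY (C L : ℕ) (x : ℕ → ℕ → ℕ) (e n : ℕ) : ℕ :=
  6911 * (2 ^ 33 * (if C ≤ e then x (e - C - 1) n else 0) +
    ((if n = 0 then 0 else convolve (digitA C L x) (fun c n => x (c - 1) n) e (n - 1)) +
      if n = 0 then 0 else if e = C ∧ n - 1 < L + 1 then
        catalan (1 + (n - 1)) * 2 ^ 63 / 8 ^ (1 + (n - 1)) else 0))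

theorem IsTable.digitA_row (hx : IsTable C L D x) (e p : ℕ) (h : C + 1 + C ≤ e) :
    digitA C L x e p = 0 := by
  rw [digitA, hx.row _ _ (by omega), if_neg (c := e = C ∧ _) (by omega)]; simp

theorem IsTable.digitA_col (hx : IsTable C L D x) (e p : ℕ) (h : L < p) :
    digitA C L x e p = 0 := by
  rw [digitA, hx.col _ _ h, if_neg (c := e = C ∧ _) (by omega)]; simp

theorem convolve_eq_zero {f g : ℕ → ℕ → ℕ} {L m m' e n : ℕ}
    (hf : ∀ c n, m ≤ c → f c n = 0) (hf' : ∀ c n, L < n → f c n = 0)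
    (hg : ∀ c n, m' ≤ c → g c n = 0) (hg' : ∀ c n, L < n → g c n = 0)
    (h : m + m' ≤ e ∨ 2 * L < n) : convolve f g e n = 0 := by
  refine sum_eq_zero fun d hd => sum_eq_zero fun p hp => ?_
  rw [mem_range] at hd hp
  rcases h with h | h
  · by_cases h1 : m' ≤ d
    · rw [hg d _ h1, mul_zero]
    · rw [hf (e - d) _ (by omega), zero_mul]
  · by_cases h1 : L < p
    · rw [hf' _ p h1, zero_mul]
    · rw [hg' _ (n - p) (by omega), mul_zero]

theorem IsTable.convolve_eq_zero (hx : IsTable C L D x) {e n : ℕ}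
    (h : C + 1 + C + (C + 1) ≤ e ∨ 2 * L < n) :
    convolve (digitA C L x) (fun c n => x (c - 1) n) e n = 0 :=
  _root_.convolve_eq_zero hx.digitA_row hx.digitA_col (m' := C + 1)
    (fun _ _ h => hx.row _ _ (by omega)) (fun _ _ h => hx.col _ _ h) h

theorem packedStep_arg_eq (hx : IsTable C L D x) (hR : R = 2 * L + 2) (hL0 : 1 ≤ L)
    (hD : 0 < D) (hDb : D ≤ b) :
    6911 * (rowsG b R (mask b R 1 0 L D) (packed b R C x) <<< (C * R * b + 33) +
      ((rowsA b R C (mask b R C 1 L D) (mask b R 1 1 L D) (ones (R * b) (C + 1))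
        (catalanRow b 30 L 1 1 <<< ((C * R + 1) * b)) (packed b R C x) *
        rowsG b R (mask b R 1 0 L D) (packed b R C x)) <<< b +
        catalanRow b 63 (L + 1) 1 1 <<< ((C * R + 1) * b))) =
    packed b R (C + 1 + C + (C + 1)) (digitY C L x) := by
  have hL : L < R := by omega
  have hG0 : ∀ c n, C + 1 ≤ c → x (c - 1) n = 0 := fun c n h => hx.row _ _ (by omega)
  have hprod : (packed b R (C + 1 + C) (digitA C L x) *
      packed b R (C + 1) fun c n => x (c - 1) n) * 2 ^ b =
      packed b R (C + 1 + C + (C + 1)) fun e n => if n = 0 then 0 else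
        convolve (digitA C L x) (fun c n => x (c - 1) n) e (n - 1) := by
    rw [packed_mul (L := L) (by omega) hx.digitA_row hx.digitA_col hG0
      (fun _ _ h => hx.col _ _ h), packed_shift_col _ (by omega)]
    exact fun c => hx.convolve_eq_zero (Or.inr (by omega))
  have hK : catalanRow b 63 (L + 1) 1 1 <<< ((C * R + 1) * b) =
      packed b R (C + 1 + C + (C + 1)) fun e n => if n = 0 then 0 else
        if e = C ∧ n - 1 < L + 1 then
        catalan (1 + (n - 1)) * 2 ^ 63 / 8 ^ (1 + (n - 1)) else 0 := by
    rw [catalanRow_one, ← packed_row (R := R) (by omega), Nat.shiftLeft_eq,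
      show 2 ^ ((C * R + 1) * b) = ((2 ^ b) ^ R) ^ C * 2 ^ b by
        rw [← pow_mul, ← pow_mul, ← pow_add]; congr 1; ring, ← mul_assoc, packed_shift_row,
      packed_shift_col _ (by omega),
      packed_extend (m' := C + 1 + C + (C + 1)) _ (by omega)]
    · refine packed_congr fun c _ n _ => ?_
      by_cases h : n = 0
      · simp [h]
      · by_cases h' : c = C
        · simp [h, h']
        · rw [if_neg h, if_neg h]
          split_ifs <;> first | rfl | omega
    · intro c n h
      split_ifs <;> first | rfl | omega
    · intro c
      split_ifs <;> first | rfl | omega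
  have hG : (packed b R (C + 1) fun c n => x (c - 1) n) <<< (C * R * b + 33) =
      packed b R (C + 1 + C + (C + 1)) fun e n =>
        2 ^ 33 * (if C ≤ e then x (e - C - 1) n else 0) := by
    rw [Nat.shiftLeft_eq, show 2 ^ (C * R * b + 33) = ((2 ^ b) ^ R) ^ C * 2 ^ 33 by
        rw [← pow_mul, ← pow_mul, ← pow_add]; congr 1; ring, ← mul_assoc, packed_shift_row,
      mul_comm, packed_mul_left]
    refine packed_extend (fun c n h => ?_) (by omega)
    rw [if_pos (by omega), hx.row _ _ (by omega), mul_zero]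
  rw [hx.rowsG_eq hL hD hDb, hx.rowsA_eq hL hL0 hD hDb, hG, hK, Nat.shiftLeft_eq, hprod,
    packed_add, packed_add, packed_mul_left]
  rfl

theorem catalan_le_pow (n : ℕ) : catalan n ≤ 4 ^ n := by
  rw [catalan_eq_centralBinom_div, Nat.centralBinom]
  refine (Nat.div_le_self _ _).trans ((Nat.choose_le_two_pow _ _).trans (le_of_eq ?_))
  rw [pow_mul]; norm_num

theorem catalan_mul_div_le (n e : ℕ) : catalan n * 2 ^ e / 8 ^ n ≤ 2 ^ e := by
  apply Nat.div_le_of_le_mul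
  exact Nat.mul_le_mul_right _ ((catalan_le_pow n).trans (Nat.pow_le_pow_left (by norm_num) n))

/-- Ensures that no carries occur, so that digits can be extracted. -/
theorem IsTable.digitY_lt (hx : IsTable C L D x) (hD : 30 ≤ D)
    (hb : 6911 * (2 ^ 33 * 2 ^ D + ((C + 1 + C + (C + 1)) * (2 * L + 1) * (2 * 2 ^ D * 2 ^ D) +
      2 ^ 63)) < 2 ^ b) (e n : ℕ) : digitY C L x e n < 2 ^ b := by
  refine lt_of_le_of_lt ?_ hb
  refine Nat.mul_le_mul_left _ (add_le_add (Nat.mul_le_mul_left _ ?_) (add_le_add ?_ ?_))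
  · split_ifs
    · exact (hx.lt _ _).le
    · exact Nat.zero_le _
  · split_ifs
    · exact Nat.zero_le _
    by_cases h : C + 1 + C + (C + 1) ≤ e ∨ 2 * L < n - 1
    · rw [hx.convolve_eq_zero h]; exact Nat.zero_le _
    · push Not at h
      have : ∀ d ∈ range (e + 1), ∑ p ∈ range (n - 1 + 1),
          digitA C L x (e - d) p * x (d - 1) (n - 1 - p) ≤ (2 * L + 1) * (2 * 2 ^ D * 2 ^ D) := by
        intro d _
        refine (sum_le_card_nsmul _ _ (2 * 2 ^ D * 2 ^ D) fun p _ => ?_).trans ?_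
        · refine Nat.mul_le_mul ?_ (hx.lt _ _).le
          rw [two_mul]
          refine add_le_add ?_ ?_
          · split_ifs
            · exact (hx.lt _ _).le
            · exact Nat.zero_le _
          · split_ifs
            · exact (catalan_mul_div_le _ _).trans (Nat.pow_le_pow_right (by norm_num) hD)
            · exact Nat.zero_le _
        · rw [card_range, smul_eq_mul]
          exact Nat.mul_le_mul_right _ (by omega)
      refine (sum_le_card_nsmul _ _ _ this).trans ?_
      rw [card_range, smul_eq_mul, mul_assoc (C + 1 + C + (C + 1))]
      exact Nat.mul_le_mul_right _ (by omega)
  · split_ifs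
    · exact Nat.zero_le _
    · exact catalan_mul_div_le _ _
    · exact Nat.zero_le _

/-- Discarding low bits, reducing modulo `2 ^ D` and dropping rows and columns can only decrease
digits, so overflow beyond `D` bits need not be excluded. -/
theorem packedStep_eq (hx : IsTable C L D x) (hR : R = 2 * L + 2) (hL0 : 1 ≤ L)
    (hD : 30 ≤ D) (hDb : D + 46 ≤ b)
    (hb : 6911 * (2 ^ 33 * 2 ^ D + ((C + 1 + C + (C + 1)) * (2 * L + 1) * (2 * 2 ^ D * 2 ^ D) +
      2 ^ 63)) < 2 ^ b) :
    ∃ x' : ℕ → ℕ → ℕ, IsTable C L D x' ∧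
      packedStep b R C (mask b R C 0 L D) (mask b R C 1 L D) (mask b R 1 0 L D)
        (mask b R 1 1 L D) (ones (R * b) (C + 1)) (catalanRow b 30 L 1 1 <<< ((C * R + 1) * b))
        (catalanRow b 63 (L + 1) 1 1 <<< ((C * R + 1) * b)) (packed b R C x) = packed b R C x' ∧
      ∀ c < C, ∀ n, x' c n * 2 ^ 46 ≤ digitY C L x (c + C) (n + 1) := by
  have hpos : 0 < 2 ^ D := by positivity
  refine ⟨fun c n => if c < C ∧ n ≤ L then (digitY C L x (c + C) (n + 1) >>> 46) % 2 ^ D else 0,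
    ⟨fun c n => ?_, fun c n h => if_neg (by omega), fun c n h => if_neg (by omega)⟩, ?_, ?_⟩
  · split_ifs
    · exact Nat.mod_lt _ hpos
    · exact hpos
  · rw [packedStep, packedStep_arg_eq hx hR hL0 (by omega) (by omega),
      mask_eq (by omega) (Nat.zero_le _),
      packed_extract (hx.digitY_lt hD hb) _ (by omega) hDb (by omega)]
    · refine packed_congr fun c hc n _ => ?_
      by_cases h : n ≤ L <;> simp [h, hc]
    · intro e n he
      rw [digitY, hx.row _ _ (by omega), hx.convolve_eq_zero (Or.inl he),
        if_neg (c := e = C ∧ _) (by omega)]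
      simp
  · intro c hc n
    simp only
    split_ifs
    · refine (Nat.mul_le_mul_right _ (Nat.mod_le _ _)).trans ?_
      rw [Nat.shiftRight_eq_div_pow]
      exact Nat.div_mul_le_self _ _
    · simp
end step

/-! ### The iteration preserves lower bounds -/

/-- `x` is a lower bound for the rescaled values of `tailSum`. -/
def IsLower (y : ℝ≥0∞) (x : ℕ → ℕ → ℕ) : Prop :=
  ∀ c n, (x c n : ℝ≥0∞) * 8 ^ n ≤ 2 ^ 30 * tailSum y (c + 1) n

section lower
variable {y : ℝ≥0∞} {x : ℕ → ℕ → ℕ}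

theorem IsLower.pred (hx : IsLower y x) (c n : ℕ) :
    (x (c - 1) n : ℝ≥0∞) * 8 ^ n ≤ 2 ^ 30 * tailSum y c n := by
  cases c with
  | zero => rw [tailSum_zero]; exact hx 0 n
  | succ c => exact hx c n

theorem catalan_div_mul_le (n e : ℕ) :
    ((catalan n * 2 ^ e / 8 ^ n : ℕ) : ℝ≥0∞) * 8 ^ n ≤ 2 ^ e * pureCount n := by
  calc ((catalan n * 2 ^ e / 8 ^ n : ℕ) : ℝ≥0∞) * 8 ^ n
      = ((catalan n * 2 ^ e / 8 ^ n * 8 ^ n : ℕ) : ℝ≥0∞) := by push_cast; rfl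
    _ ≤ ((catalan n * 2 ^ e : ℕ) : ℝ≥0∞) := by exact_mod_cast Nat.div_mul_le_self _ _
    _ = 2 ^ e * catalan n := by push_cast; ring
    _ ≤ _ := by gcongr; exact catalan_le_pureCount n

theorem IsLower.digitA_le (hx : IsLower y x) {C L c d p : ℕ} (hd : d ≤ C) :
    (digitA C L x (c + C - d) (p + 1) : ℝ≥0∞) * 8 ^ (p + 1) ≤
      2 ^ 30 * (tailSum y (c - d) (p + 1) + if d = c then pureCount (p + 1) else 0) := by
  rw [digitA, if_pos (by omega), Nat.cast_add, add_mul, mul_add]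
  refine add_le_add ?_ ?_
  · rw [show c + C - d - C = c - d by omega]
    exact hx.pred _ _
  · by_cases h : d = c
    · rw [if_pos h]
      split_ifs
      · exact catalan_div_mul_le _ _
      · simp
    · rw [if_neg (by omega)]; simp

theorem digitA_zero (C L : ℕ) (x : ℕ → ℕ → ℕ) (e : ℕ) : digitA C L x e 0 = 0 := by
  simp [digitA]

theorem IsLower.convolve_le (hx : IsLower y x) {C L D c n : ℕ} (hT : IsTable C L D x) (hc : c < C) :
    (convolve (digitA C L x) (fun c n => x (c - 1) n) (c + C) n : ℝ≥0∞) * 8 ^ n ≤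
      2 ^ 60 * ∑ i ∈ range n, (pureCount (i + 1) * tailSum y c (n - 1 - i) +
        ∑ d ∈ range (C + 1), tailSum y (c - d) (i + 1) * tailSum y d (n - 1 - i)) := by
  have h1 : convolve (digitA C L x) (fun c n => x (c - 1) n) (c + C) n =
      ∑ i ∈ range n, ∑ d ∈ range (C + 1),
        digitA C L x (c + C - d) (i + 1) * x (d - 1) (n - 1 - i) := by
    rw [convolve, ← sum_subset (s₁ := range (C + 1)) (range_subset_range.2 (by omega))]
    · rw [sum_comm]
      rw [sum_range_succ']
      simp only [digitA_zero, zero_mul, sum_const_zero, add_zero]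
      refine sum_congr rfl fun i _ => sum_congr rfl fun d _ => ?_
      rw [show n - (i + 1) = n - 1 - i by omega]
    · intro d _ hd
      refine sum_eq_zero fun p _ => ?_
      rw [hT.row (d - 1) _ (by simp at hd; omega), mul_zero]
  rw [h1]
  push_cast
  rw [sum_mul, mul_sum]
  refine sum_le_sum fun i hi => ?_
  have hi := mem_range.1 hi
  -- The term with empty left body joins the sum at `d = c`, matching the Catalan entries in row `C`
  -- of `digitA`.
  have h2 : pureCount (i + 1) * tailSum y c (n - 1 - i) = ∑ d ∈ range (C + 1),
      (if d = c then pureCount (i + 1) else 0) * tailSum y d (n - 1 - i) := by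
    simp only [ite_mul, zero_mul]
    rw [sum_ite_eq', if_pos (by simp; omega)]
  rw [h2, ← sum_add_distrib, sum_mul, mul_sum]
  refine sum_le_sum fun d hd => ?_
  have hd := mem_range.1 hd
  rw [← add_mul, show (8 : ℝ≥0∞) ^ n = 8 ^ (i + 1) * 8 ^ (n - 1 - i) by
    rw [← pow_add]; congr 1; omega, mul_mul_mul_comm]
  refine (mul_le_mul' (hx.digitA_le (by omega)) (hx.pred d _)).trans (le_of_eq ?_)
  rw [mul_mul_mul_comm, ← pow_add, add_comm (tailSum _ _ _)]

/-- The scale is `2 ^ 30`, with column `n` divided by `8 ^ n`. Products have scale `2 ^ 60`; the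
factors `2 ^ 33` and `2 ^ 63` bring the linear terms there, with `2 ^ 3` compensating for column `n
+ 1`. Dividing by `2 ^ 46` restores the scale `2 ^ 30` and supplies the denominator `2 ^ 16` of `y`.
-/
theorem IsLower.step (hx : IsLower y x) (hy : 2 ^ 16 * y = 6911) {C L D : ℕ}
    (hT : IsTable C L D x) {x' : ℕ → ℕ → ℕ} (hT' : IsTable C L D x')
    (h : ∀ c < C, ∀ n, x' c n * 2 ^ 46 ≤ digitY C L x (c + C) (n + 1)) : IsLower y x' := by
  intro c n
  by_cases hc : C ≤ c
  · rw [hT'.row _ _ hc]; simp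
  push Not at hc
  refine le_trans ?_ (mul_le_mul' le_rfl (tailSum_succ_ge C c n y))
  have h0 := h c hc n
  have h1 : digitY C L x (c + C) (n + 1) = 6911 * (2 ^ 33 * x (c - 1) (n + 1) +
      (convolve (digitA C L x) (fun c n => x (c - 1) n) (c + C) n +
        if c = 0 ∧ n < L + 1 then catalan (n + 1) * 2 ^ 63 / 8 ^ (n + 1) else 0)) := by
    rw [digitY, if_pos (by omega), if_neg (by omega), if_neg (by omega),
      show c + C - C - 1 = c - 1 by omega, Nat.add_sub_cancel, add_comm 1 n]
    simp only [Nat.add_eq_right]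
  have hA : ((2 ^ 33 * x (c - 1) (n + 1) : ℕ) : ℝ≥0∞) * 8 ^ n ≤ 2 ^ 60 * tailSum y c (n + 1) :=
    calc ((2 ^ 33 * x (c - 1) (n + 1) : ℕ) : ℝ≥0∞) * 8 ^ n
        = 2 ^ 30 * (x (c - 1) (n + 1) * 8 ^ (n + 1)) := by push_cast; ring
      _ ≤ 2 ^ 30 * (2 ^ 30 * tailSum y c (n + 1)) := mul_le_mul' le_rfl (hx.pred _ _)
      _ = _ := by rw [← mul_assoc, ← pow_add]
  have hC : ((if c = 0 ∧ n < L + 1 then catalan (n + 1) * 2 ^ 63 / 8 ^ (n + 1) else 0 : ℕ) :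
      ℝ≥0∞) * 8 ^ n ≤ 2 ^ 60 * (if c = 0 then pureCount (n + 1) else 0) := by
    split_ifs with h2 h3 h3
    · rw [← ENNReal.mul_le_mul_iff_right (a := 8) (by norm_num) (by finiteness)]
      calc _ = ((catalan (n + 1) * 2 ^ 63 / 8 ^ (n + 1) : ℕ) : ℝ≥0∞) * 8 ^ (n + 1) := by
            rw [pow_succ]; ring
        _ ≤ 2 ^ 63 * pureCount (n + 1) := catalan_div_mul_le _ _
        _ = _ := by rw [← mul_assoc]; congr 1; norm_num
    · exact absurd h2.1 h3
    · simp
    · simp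
  have h46 : (2 : ℝ≥0∞) ^ 46 ≠ 0 := by positivity
  have h46' : (2 : ℝ≥0∞) ^ 46 ≠ ⊤ := by finiteness
  rw [← ENNReal.mul_le_mul_iff_right h46 h46']
  calc (2 : ℝ≥0∞) ^ 46 * (x' c n * 8 ^ n) = ((x' c n * 2 ^ 46 : ℕ) : ℝ≥0∞) * 8 ^ n := by
        push_cast; ring
    _ ≤ (digitY C L x (c + C) (n + 1) : ℝ≥0∞) * 8 ^ n := by gcongr
    _ ≤ 6911 * (2 ^ 60 * ((if c = 0 then pureCount (n + 1) else 0) + tailSum y c (n + 1) +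
      ∑ i ∈ range n, (pureCount (i + 1) * tailSum y c (n - 1 - i) +
        ∑ d ∈ range (C + 1), tailSum y (c - d) (i + 1) * tailSum y d (n - 1 - i)))) := by
        rw [h1, Nat.cast_mul, Nat.cast_add, Nat.cast_add, mul_assoc, add_mul, add_mul]
        refine mul_le_mul' le_rfl ?_
        rw [mul_add, mul_add, add_comm (2 ^ 60 * ite _ _ _), add_assoc, add_comm (2 ^ 60 * ite _ _ _)]
        exact add_le_add hA (add_le_add (hx.convolve_le hT hc) hC)
    _ = 2 ^ 46 * (2 ^ 30 * (y * _)) := by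
        rw [← hy]; ring
end lower

/-! ### Numerical evaluation -/

open scoped ENNReal NNReal

/-- `f n`, stated so that evaluation reduces `n` to a numeral first. -/
def force (n : ℕ) (f : ℕ → ℕ) : ℕ := Nat.rec (f 0) (fun k _ => f (k + 1)) n

theorem force_eq (n : ℕ) (f : ℕ → ℕ) : force n f = f n := by cases n <;> rfl

def packedIter (b R C M M1 Mr Mr1 O K1 K2 : ℕ) : ℕ → ℕ → ℕ
  | 0, x => x
  | t + 1, x => force x fun x => packedIter b R C M M1 Mr Mr1 O K1 K2 t
      (packedStep b R C M M1 Mr Mr1 O K1 K2 x)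

/-- The iteration started at the zero table. -/
def packedRun (b R C L D t : ℕ) : ℕ :=
  force (mask b R C 0 L D) fun M => force (mask b R C 1 L D) fun M1 =>
  force (mask b R 1 0 L D) fun Mr => force (mask b R 1 1 L D) fun Mr1 =>
  force (ones (R * b) (C + 1)) fun O =>
  force (catalanRow b 30 L 1 1 <<< ((C * R + 1) * b)) fun K1 =>
  force (catalanRow b 63 (L + 1) 1 1 <<< ((C * R + 1) * b)) fun K2 =>
    packedIter b R C M M1 Mr Mr1 O K1 K2 t 0

theorem packedRun_eq {b R C L D : ℕ} {y : ℝ≥0∞} (hy : 2 ^ 16 * y = 6911) (hR : R = 2 * L + 2)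
    (hL0 : 1 ≤ L) (hD : 30 ≤ D) (hDb : D + 46 ≤ b)
    (hb : 6911 * (2 ^ 33 * 2 ^ D + ((C + 1 + C + (C + 1)) * (2 * L + 1) * (2 * 2 ^ D * 2 ^ D) +
      2 ^ 63)) < 2 ^ b) (t : ℕ) :
    ∃ x, IsTable C L D x ∧ IsLower y x ∧ packedRun b R C L D t = packed b R C x := by
  have h0 : packed b R C (fun _ _ => 0) = 0 := by simp [packed]
  have hT0 : IsTable C L D fun _ _ => 0 :=
    ⟨fun _ _ => by positivity, fun _ _ _ => rfl, fun _ _ _ => rfl⟩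
  have hx0 : IsLower y fun _ _ => 0 := fun c n => by simp
  suffices H : ∀ x, IsTable C L D x → IsLower y x → ∃ x', IsTable C L D x' ∧ IsLower y x' ∧
      packedIter b R C (mask b R C 0 L D) (mask b R C 1 L D) (mask b R 1 0 L D)
        (mask b R 1 1 L D) (ones (R * b) (C + 1)) (catalanRow b 30 L 1 1 <<< ((C * R + 1) * b))
        (catalanRow b 63 (L + 1) 1 1 <<< ((C * R + 1) * b)) t (packed b R C x) =
        packed b R C x' by
    have := H _ hT0 hx0
    rw [h0] at this
    simpa only [packedRun, force_eq] using this
  clear hT0 hx0 h0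
  induction t with
  | zero => exact fun x hT hx => ⟨x, hT, hx, rfl⟩
  | succ t ih =>
    intro x hT hx
    rw [packedIter, force_eq]
    obtain ⟨x', hT', he, hx'⟩ := packedStep_eq hT hR hL0 hD hDb hb
    rw [he]
    exact ih x' hT' (hx.step hy hT hT' hx')

theorem packed_mod {b R C : ℕ} {x : ℕ → ℕ → ℕ} (hR : 0 < R) (hC : 0 < C) :
    packed b R C x % 2 ^ b = x 0 0 % 2 ^ b := by
  obtain ⟨N, hN⟩ : ∃ N, C * R = N + 1 := ⟨C * R - 1, by have := Nat.mul_pos hC hR; omega⟩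
  have hd : 2 ^ b ∣ ∑ i ∈ range N, x ((i + 1) / R) ((i + 1) % R) * (2 ^ b) ^ (i + 1) :=
    dvd_sum fun i _ => Dvd.dvd.mul_left (dvd_pow_self _ (by omega)) _
  rw [packed_eq_sum hR, hN, sum_range_succ', Nat.add_mod, Nat.mod_eq_zero_of_dvd hd, zero_add,
    Nat.mod_mod]
  simp

/-- 712 steps on a table with 44 rows and columns 0 to 48, of 41-bit entries in 110-bit digits. The
lowest digit is the entry for one cut and empty tail. -/
theorem packedRun_ge : 730 * 2 ^ 30 ≤ packedRun 110 98 44 48 41 712 % 2 ^ 110 := by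
  apply Nat.le_of_ble_eq_true
  decide +kernel

theorem le_tailSum {y : ℝ≥0∞} (hy : 2 ^ 16 * y = 6911) : 730 ≤ tailSum y 1 0 := by
  obtain ⟨x, -, hx, he⟩ := packedRun_eq (b := 110) (R := 98) (C := 44) (L := 48) (D := 41) hy
    (by norm_num) (by norm_num) (by norm_num) (by norm_num) (by norm_num) 712
  have h1 := packedRun_ge
  rw [he, packed_mod (by norm_num) (by norm_num)] at h1
  have h2 : (730 * 2 ^ 30 : ℕ) ≤ x 0 0 := h1.trans (Nat.mod_le _ _)
  have h3 : ((730 * 2 ^ 30 : ℕ) : ℝ≥0∞) ≤ x 0 0 := by exact_mod_cast h2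
  have h4 := hx 0 0
  rw [pow_zero, mul_one, zero_add] at h4
  have h5 := h3.trans h4
  rw [Nat.cast_mul, mul_comm, Nat.cast_pow] at h5
  exact (ENNReal.mul_le_mul_iff_right (by positivity) (by finiteness)).1 h5

/-! ### Comparison with the binomial coefficients -/

theorem not_forall_W_le : ¬ ∀ n, W 3 (n + 1) * 27 ^ n ≤ 256 ^ n := by
  intro h
  set y : ℝ≥0 := 6911 / 65536 with hy
  -- The ratio `256 * y / 27` of the dominating geometric series; its sum `6912 * y` is below 729.
  set r : ℝ≥0 := 6911 / 6912 with hr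
  have hyr : 27 * r = 256 * y := by rw [hy, hr, ← NNReal.coe_inj]; push_cast; norm_num
  have hy' : (2 : ℝ≥0∞) ^ 16 * y = 6911 := by
    have : (2 : ℝ≥0) ^ 16 * y = 6911 := by rw [hy, ← NNReal.coe_inj]; push_cast; norm_num
    exact_mod_cast this
  have hle : ∀ n, (W 3 (n + 1) : ℝ≥0∞) * (y : ℝ≥0∞) ^ (n + 1) ≤ y * (r : ℝ≥0∞) ^ n := by
    intro n
    have h1 : (W 3 (n + 1) : ℝ≥0) * 27 ^ n ≤ 256 ^ n := by exact_mod_cast h n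
    have h2 : (W 3 (n + 1) : ℝ≥0) * y ^ n ≤ r ^ n := by
      refine le_of_mul_le_mul_left ?_ (by positivity : (0 : ℝ≥0) < 27 ^ n)
      calc (27 : ℝ≥0) ^ n * (W 3 (n + 1) * y ^ n) = W 3 (n + 1) * 27 ^ n * y ^ n := by ring
        _ ≤ 256 ^ n * y ^ n := by gcongr
        _ = 27 ^ n * r ^ n := by rw [← mul_pow, ← mul_pow, hyr]
    have h3 : (W 3 (n + 1) : ℝ≥0) * y ^ (n + 1) ≤ y * r ^ n := by
      rw [pow_succ, ← mul_assoc, mul_comm]; gcongr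
    exact_mod_cast h3
  have hr1 : (1 - (r : ℝ≥0∞))⁻¹ = 6912 := by
    have h1 : 1 - (r : ℝ≥0∞) = ((1 / 6912 : ℝ≥0) : ℝ≥0∞) := by
      refine (ENNReal.eq_sub_of_add_eq ENNReal.coe_ne_top ?_).symm
      rw [← ENNReal.coe_add, ← ENNReal.coe_one, ENNReal.coe_inj, hr, ← NNReal.coe_inj]
      push_cast; norm_num
    rw [h1, ← ENNReal.coe_inv (by positivity)]
    norm_num
  have h1 := (le_tailSum hy').trans ((tailSum_one_zero_le _).trans (ENNReal.tsum_le_tsum hle))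
  rw [ENNReal.tsum_mul_left, ENNReal.tsum_geometric, hr1] at h1
  have h2 : (730 : ℝ≥0) ≤ y * 6912 := by exact_mod_cast h1
  rw [hy, ← NNReal.coe_le_coe] at h2
  push_cast at h2
  norm_num at h2

/-- A single term in the binomial expansion of `(1 + 3) ^ (4 * n)`. -/
theorem choose_four_mul_le (n : ℕ) : (4 * n).choose n * 27 ^ n ≤ 256 ^ n := by
  have h1 := add_pow 1 3 (4 * n)
  simp only [Nat.cast_id] at h1
  have h2 := single_le_sum (f := fun m => 1 ^ m * 3 ^ (4 * n - m) * (4 * n).choose m)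
    (fun _ _ => Nat.zero_le _) (mem_range.2 (by omega : n < 4 * n + 1))
  rw [← h1, one_pow, one_mul, show 4 * n - n = 3 * n by omega, pow_mul, pow_mul] at h2
  rw [mul_comm]
  exact h2

theorem W_one_le (t : ℕ) : W t 1 ≤ 1 := (card_filter_le _ _).trans <|
  (List.toFinset_card_le _).trans (by simp [List.length_permutations])

theorem exists_forall_choose_lt_W (h : LogConvexSeq fun n => (W 3 n : ℝ)) :
    ∃ N : ℕ, ∀ n, N ≤ n → (4 * n).choose n < W 3 n := by
  obtain ⟨hpos, hmono⟩ := h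
  simp only at hpos hmono
  by_cases hex : ∃ m, 1 ≤ m ∧ (256 / 27 : ℝ) < W 3 (m + 1) / W 3 m
  · obtain ⟨m, hm, hlt⟩ := hex
    set r : ℝ := W 3 (m + 1) / W 3 m with hr
    have hr0 : 0 < r := lt_trans (by norm_num) hlt
    have hratio : ∀ k, r ≤ (W 3 (m + k + 1) : ℝ) / W 3 (m + k) := by
      intro k
      induction k with
      | zero => exact le_rfl
      | succ k ih => exact ih.trans (hmono (m + k) (by omega))
    have hge : ∀ k, (W 3 m : ℝ) * r ^ k ≤ W 3 (m + k) := by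
      intro k
      induction k with
      | zero => simp
      | succ k ih =>
        have h1 := (le_div_iff₀ (hpos (m + k) (by omega))).1 (hratio k)
        calc (W 3 m : ℝ) * r ^ (k + 1) = r * (W 3 m * r ^ k) := by ring
          _ ≤ r * W 3 (m + k) := by gcongr
          _ ≤ _ := h1
    have hWm := hpos m hm
    have hbig : 1 < r / (256 / 27) := (one_lt_div (by norm_num)).2 hlt
    obtain ⟨K, hK⟩ := Filter.eventually_atTop.1
      ((tendsto_pow_atTop_atTop_of_one_lt hbig).eventually_gt_atTop ((256 / 27 : ℝ) ^ m / W 3 m))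
    refine ⟨m + K, fun n hn => ?_⟩
    obtain ⟨k, rfl⟩ : ∃ k, n = m + k := ⟨n - m, by omega⟩
    have h1 := hK k (by omega)
    rw [div_pow r, lt_div_iff₀ (by positivity), div_mul_eq_mul_div, div_lt_iff₀ hWm, ← pow_add] at h1
    have h2 : (((4 * (m + k)).choose (m + k) : ℕ) : ℝ) ≤ (256 / 27) ^ (m + k) := by
      rw [div_pow, le_div_iff₀ (by positivity)]
      exact_mod_cast choose_four_mul_le (m + k)
    have h3 := hge k
    have : (((4 * (m + k)).choose (m + k) : ℕ) : ℝ) < W 3 (m + k) := by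
      calc _ ≤ (256 / 27 : ℝ) ^ (m + k) := h2
        _ < r ^ k * W 3 m := h1
        _ ≤ _ := by rw [mul_comm]; exact h3
    exact_mod_cast this
  -- All ratios are at most `256/27`, and `W 3 1 ≤ 1` starts the induction towards the bound that
  -- `not_forall_W_le` refutes.
  · push Not at hex
    refine absurd (fun n => ?_) not_forall_W_le
    have : (W 3 (n + 1) : ℝ) ≤ (256 / 27) ^ n := by
      induction n with
      | zero => simpa using W_one_le 3
      | succ n ih =>
        have h1 := (div_le_iff₀ (hpos (n + 1) (by omega))).1 (hex (n + 1) (by omega))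
        refine h1.trans ?_
        rw [pow_succ']
        gcongr
    rw [div_pow, le_div_iff₀ (by positivity)] at this
    exact_mod_cast this

theorem theorem12 :
    (LogConvexSeq (fun n => (W 3 n : ℝ)) →
      ∃ N : ℕ, ∀ n : ℕ, N ≤ n → (4 * n).choose n < W 3 n) ∧
    ¬ (BonaBoundConjecture ∧ BonaLogConvexConjecture) := by
  refine ⟨exists_forall_choose_lt_W, fun ⟨h1, h2⟩ => ?_⟩
  obtain ⟨N, hN⟩ := exists_forall_choose_lt_W (h2 3 (by norm_num))
  exact absurd (h1 (N + 1) 3 (by omega) (by norm_num)) (not_le.2 (hN (N + 1) (by omega)))
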